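/- For each natural number $n\ge 1$ let $I(n)$ be a union of at most $k$ (possibly empty) intervals of real numbers, where $k$ does not depend on $n$. Let $\mathcal{B}=\mathcal{B}_I$ be the set consisting of $1$ and of all integers $n\ge 2$ whose prime factorization $n=p_1\cdots p_r$, $p_1\le p_2\le\dots\le p_r$, satisfies $p_j\in I\bigl(\prod_{1\le i<j}p_i\bigr)$ for all $1\le j\le r$. Put $\mathcal{B}(x)=\mathcal{B}\cap[1,x]$ and $e(y)=e^{2\pi i y}$. Theorem 3 (Minor Arcs). Let $\kappa<1/\sqrt6$ and $k$ be constant. Let $x\ge \mathrm{e}=\exp(1)$ be real, let $L=\log x$, and let $R$ be a real number with $$1\le R\le \exp\bigl(\kappa\sqrt{\log x\,\log\log x}\bigr).$$ Let $h,a,q\ge 1$ be integers with $h\le R$, $(a,q)=1$ and $$R^{12}L^{26}<q\le \frac{x}{R^{11}L^{26}},$$ and let $\alpha$ be a real number with $|\alpha-a/q|\le 1/q^2$. Then $$\sum_{n\in\mathcal{B}(x)}e(\alpha hn)\ll\frac{x}{R},$$ where the implied constant depends only on $\kappa$ and $k$; in particular it does not depend on the choice of the intervals that make up the sets $I(n)$.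 -/

import Mathlib

namespace PrimeIntervalSeq

/-- A set of reals which is the union of at most `k` intervals. An interval is an order-connected
(equivalently, convex) subset of `ℝ`: open, closed, half-open, bounded or not, a point, or empty. -/
def IsUnionOfIntervals (k : ℕ) (S : Set ℝ) : Prop :=
  ∃ J : Fin k → Set ℝ, (∀ i, (J i).OrdConnected) ∧ S = ⋃ i, J i

/-- The set `𝓑_I` of positive integers `n = p_1 ⋯ p_k` (`p_1 ≤ ⋯ ≤ p_k` primes) such that
`p_j ∈ I (∏_{i < j} p_i)` for all `j`. The list `n.primeFactorsList` is the nondecreasing list of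
the prime factors of `n` with multiplicity, indexed from `0`. It is empty for `n = 1`, so that
`1` is a member. -/
def seqB (I : ℕ → Set ℝ) : Set ℕ :=
  {n | 0 < n ∧ ∀ j : Fin n.primeFactorsList.length,
    ((n.primeFactorsList.get j : ℕ) : ℝ) ∈ I ((n.primeFactorsList.take j).prod)}

/-- `e(y) = exp(2πiy)`. -/
noncomputable def e (y : ℝ) : ℂ := Complex.exp (2 * (Real.pi : ℂ) * Complex.I * (y : ℂ))

open Classical in
/-- The exponential sum `∑_{n ∈ 𝓑_I, n ≤ x} e(β n)`. -/
noncomputable def expSum (I : ℕ → Set ℝ) (x β : ℝ) : ℂ :=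
  ∑ n ∈ (Finset.Icc 1 ⌊x⌋₊).filter (fun n => n ∈ seqB I), e (β * (n : ℝ))

end PrimeIntervalSeq

namespace PrimeIntervalSeq

open Finset

/-! Write n = mp with p the largest prime factor. Then n ∈ 𝓑 exactly when m ∈ 𝓑 and p ∈ I(m)
(`mul_mem_seqB_iff`), so for fixed m the primes p run over at most k intervals, and
inclusion–exclusion reduces matters to sums of e(αhmp) over the primes of one interval, at the cost
of a factor 2^k. As I is arbitrary, every bound must be uniform in that interval.

Let y ≈ R²L¹² and z ≈ R³L¹². The n with no prime factor above y are few by Rankin's method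
(`card_smooth_le_rankin`, `sum_card_smooth_le_div`).

For m > z the sum is bilinear. Expanding a mean square leads to geometric sums, which the
approximation a/q controls on average. A binary decomposition of intervals makes the estimate
maximal, so that the inner interval may depend on the outer variable (`sum_norm_interval_sq_le`).

For m ≤ z a prime sum is unfolded by a Vaughan-type identity. A full linear sum over multiples of d,
split by largest prime factor, is a sum over l = dm' ≤ z of large-prime sums at level l, plus smooth
numbers, small primes and terms with l > z. Weighting by μ(d) isolates l = 1 (`sum_moebius_mul_sum`,
`norm_primeSum_le`). The linear sums are at most q each, since h times the frequencies stays below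
q/2; the terms with l > z are again bilinear, now with multiplicity at most τ₃(l) (`sum_triple_le`,
`norm_expSum_le`).

Cauchy–Schwarz with ∑ τ₃(l)²/l ≤ (1 + log X)⁹ finishes: the square of the bilinear part loses L¹² in
all, which the cutoffs y and z repay. -/

/-! ### Additive characters and geometric sums. -/

lemma e_add (s t : ℝ) : e (s + t) = e s * e t := by
  simp only [e, ← Complex.exp_add]
  congr 1
  push_cast
  ring

lemma e_eq (t : ℝ) : e t = Complex.exp (((2 * Real.pi * t : ℝ) : ℂ) * Complex.I) := by
  unfold e
  congr 1
  push_cast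
  ring

@[simp] lemma norm_e (t : ℝ) : ‖e t‖ = 1 := by
  rw [e_eq, Complex.norm_exp_ofReal_mul_I]

lemma e_mul_natCast (t : ℝ) (n : ℕ) : e (t * n) = e t ^ n := by
  unfold e
  rw [← Complex.exp_nat_mul]
  congr 1
  push_cast
  ring

lemma conj_e (t : ℝ) : (starRingEnd ℂ) (e t) = e (-t) := by
  rw [e_eq, e_eq, ← Complex.exp_conj]
  congr 1
  simp [Complex.conj_ofReal, -Complex.ofReal_mul]

lemma e_sub_int (t : ℝ) (n : ℤ) : e (t - n) = e t := by
  have h1 : e (-(n : ℝ)) = 1 := by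
    unfold e
    rw [Complex.exp_eq_one_iff]
    exact ⟨-n, by push_cast; ring⟩
  rw [sub_eq_add_neg, e_add, h1, mul_one]

/-- The distance of `t` to the nearest integer is at most `|e(t) - 1| / 4`. -/
lemma norm_e_sub_one_ge (t : ℝ) : 4 * ‖(t : UnitAddCircle)‖ ≤ ‖e t - 1‖ := by
  rw [UnitAddCircle.norm_eq, ← e_sub_int t (round t)]
  set u := t - round t with hu
  have hu2 : |u| ≤ 1 / 2 := abs_sub_round t
  have h1 : ‖e u - 1‖ = 2 * |Real.sin (Real.pi * u)| := by
    have := Complex.norm_exp_I_mul_ofReal_sub_one (2 * Real.pi * u)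
    rw [e_eq, mul_comm _ Complex.I, this, Real.norm_eq_abs, abs_mul, abs_two]
    congr 3
    ring
  have h2 : |Real.sin (Real.pi * u)| = Real.sin (Real.pi * |u|) := by
    have h0 : 0 ≤ Real.sin (Real.pi * |u|) := by
      apply Real.sin_nonneg_of_nonneg_of_le_pi
      · positivity
      · nlinarith [Real.pi_pos]
    rcases abs_cases u with ⟨h, _⟩ | ⟨h, _⟩
    · rw [h] at h0 ⊢
      exact abs_of_nonneg h0
    · rw [h] at h0 ⊢
      rw [mul_neg, Real.sin_neg] at h0 ⊢
      exact abs_of_nonpos (by linarith)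
  have h3 : 2 / Real.pi * (Real.pi * |u|) ≤ Real.sin (Real.pi * |u|) := by
    apply Real.mul_le_sin
    · positivity
    · nlinarith [Real.pi_pos]
  have h4 : 2 / Real.pi * (Real.pi * |u|) = 2 * |u| := by
    field_simp
  rw [h1, h2]
  linarith

/-- Multiplication by `e t - 1` telescopes the sum. The product form stays valid when `t` is an
integer, where a quotient would not. -/
lemma norm_sum_e_mul_dist_le (t : ℝ) (A B : ℕ) :
    ‖∑ n ∈ Ioc A B, e (t * n)‖ * (2 * ‖(t : UnitAddCircle)‖) ≤ 1 := by
  have h0 : (∑ n ∈ Ioc A B, e (t * n)) * (e t - 1) =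
      if A ≤ B then e t ^ (B + 1) - e t ^ (A + 1) else 0 := by
    split_ifs with h
    · simp_rw [e_mul_natCast]
      induction B, h using Nat.le_induction with
      | base => simp
      | succ B hB ih =>
        rw [← Finset.insert_Ioc_right_eq_Ioc_add_one hB, sum_insert (by simp), add_mul, ih]
        ring
    · rw [Ioc_eq_empty_of_le (by omega)]
      simp
  have h1 : ‖(∑ n ∈ Ioc A B, e (t * n)) * (e t - 1)‖ ≤ 2 := by
    rw [h0]
    split_ifs
    · refine (norm_sub_le _ _).trans ?_
      simp only [norm_pow, norm_e, one_pow]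
      norm_num
    · simp
  rw [norm_mul] at h1
  have h2 := norm_e_sub_one_ge t
  nlinarith [norm_nonneg (∑ n ∈ Ioc A B, e (t * n))]

lemma norm_sum_e_le_card (t : ℝ) (A B : ℕ) : ‖∑ n ∈ Ioc A B, e (t * n)‖ ≤ ((B - A : ℕ) : ℝ) := by
  refine (norm_sum_le _ _).trans ?_
  simp

/-! ### The kernel min(M, 1/(2‖t‖)) and its majorant on residue classes. -/

/-- `min (M, 1 / (2 ‖t‖))`, where `‖t‖` is the distance to the nearest integer. -/
noncomputable def distKernel (M t : ℝ) : ℝ := (max M⁻¹ (2 * ‖(t : UnitAddCircle)‖))⁻¹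

lemma distKernel_le {M : ℝ} (hM : 0 < M) (t : ℝ) : distKernel M t ≤ M := by
  unfold distKernel
  rw [inv_le_comm₀ (by positivity) hM]
  exact le_max_left _ _

lemma distKernel_nonneg {M : ℝ} (hM : 0 < M) (t : ℝ) : 0 ≤ distKernel M t := by
  unfold distKernel
  positivity

lemma distKernel_le_of_le {M t s : ℝ} (hs : 0 < s) (h : s ≤ ‖(t : UnitAddCircle)‖) :
    distKernel M t ≤ 1 / (2 * s) := by
  unfold distKernel
  rw [one_div]
  apply inv_anti₀ (by positivity)
  exact le_max_of_le_right (by linarith)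

lemma le_distKernel {M t a : ℝ} (hM : 0 < M) (h : a ≤ M) (ha : 0 ≤ a)
    (h' : a * (2 * ‖(t : UnitAddCircle)‖) ≤ 1) : a ≤ distKernel M t := by
  unfold distKernel
  have hp : 0 < max M⁻¹ (2 * ‖(t : UnitAddCircle)‖) := by positivity
  rw [← one_div, le_div_iff₀ hp, mul_max_of_nonneg _ _ ha]
  refine max_le ?_ h'
  rw [← div_eq_mul_inv]
  exact div_le_one_of_le₀ h hM.le

lemma distKernel_neg (M t : ℝ) : distKernel M (-t) = distKernel M t := by
  unfold distKernel
  rw [AddCircle.coe_neg, norm_neg]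

lemma norm_sum_e_le_distKernel (t : ℝ) {M : ℕ} (hM : 0 < M) :
    ‖∑ n ∈ Ioc M (2 * M), e (t * n)‖ ≤ distKernel M t := by
  apply le_distKernel (by exact_mod_cast hM) _ (norm_nonneg _) (norm_sum_e_mul_dist_le _ _ _)
  refine (norm_sum_e_le_card _ _ _).trans ?_
  exact_mod_cast (by omega : 2 * M - M ≤ M)

lemma le_norm_unitAddCircle {u s : ℝ} (h1 : s ≤ u) (h2 : s ≤ 1 - u) :
    s ≤ ‖(u : UnitAddCircle)‖ := by
  rw [UnitAddCircle.norm_eq]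
  rcases le_or_gt (round u) 0 with h | h
  · have : ((round u : ℤ) : ℝ) ≤ 0 := by exact_mod_cast h
    exact le_trans (by linarith) (le_abs_self _)
  · have : (1 : ℝ) ≤ ((round u : ℤ) : ℝ) := by exact_mod_cast h
    exact le_trans (by linarith) (neg_le_abs _)

lemma norm_unitAddCircle_add_int (u : ℝ) (n : ℤ) :
    ‖((u + n : ℝ) : UnitAddCircle)‖ = ‖(u : UnitAddCircle)‖ := by
  rw [UnitAddCircle.norm_eq, UnitAddCircle.norm_eq, round_add_intCast]
  push_cast
  congr 1
  ring

/-- Majorant of `distKernel M t` when `t` is within `O(1 / q)` of `s / q`. -/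
noncomputable def residueMajorant (M : ℝ) (q s : ℕ) : ℝ :=
  (if s < 2 then M else 0) + (if q ≤ s + 2 then M else 0)
    + q / 2 * (((s - 1 : ℕ) : ℝ))⁻¹ + q / 2 * (((q - 1 - s - 1 : ℕ) : ℝ))⁻¹

lemma residueMajorant_nonneg {M : ℝ} (hM : 0 < M) (q s : ℕ) : 0 ≤ residueMajorant M q s := by
  unfold residueMajorant
  have h1 : 0 ≤ (if s < 2 then M else 0) := by split_ifs <;> linarith
  have h2 : 0 ≤ (if q ≤ s + 2 then M else 0) := by split_ifs <;> linarith
  positivity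

/-- Away from the residues nearest 0 the point lies at distance at least min(s - 1, q - s - 2)/q
from the integers; adding both reciprocals avoids a minimum. The at most four exceptional residues
get the trivial bound `M`. -/
lemma distKernel_le_residueMajorant {M : ℝ} (hM : 0 < M) {q : ℕ} (hq : 0 < q) (v : ℤ) {τ : ℝ}
    (h1 : -1 ≤ τ) (h2 : τ ≤ 2) :
    distKernel M ((v + τ) / q) ≤ residueMajorant M q (v % q).toNat := by
  have hq' : (0 : ℝ) < q := by exact_mod_cast hq
  obtain ⟨s, hs⟩ : ∃ s : ℕ, v % q = s := ⟨(v % q).toNat, by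
    rw [Int.toNat_of_nonneg (Int.emod_nonneg _ (by omega))]⟩
  have hsq : s < q := by
    have := Int.emod_lt_of_pos v (by omega : (0 : ℤ) < q)
    omega
  rw [hs, Int.toNat_natCast]
  have hv : (v : ℝ) = s + q * (v / q : ℤ) := by
    have := Int.emod_add_mul_ediv v q
    rw [hs] at this
    exact_mod_cast this.symm
  have e1 : 0 ≤ (q : ℝ) / 2 * (((s - 1 : ℕ) : ℝ))⁻¹ := by positivity
  have e2 : 0 ≤ (q : ℝ) / 2 * (((q - 1 - s - 1 : ℕ) : ℝ))⁻¹ := by positivity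
  by_cases c1 : s < 2
  · refine (distKernel_le hM _).trans ?_
    unfold residueMajorant
    rw [if_pos c1]
    have : 0 ≤ (if q ≤ s + 2 then M else 0) := by split_ifs <;> linarith
    linarith
  by_cases c2 : q ≤ s + 2
  · refine (distKernel_le hM _).trans ?_
    unfold residueMajorant
    rw [if_pos c2, if_neg c1]
    linarith
  unfold residueMajorant
  rw [if_neg c1, if_neg c2]
  have hs1 : ((s - 1 : ℕ) : ℝ) = s - 1 := by
    rw [Nat.cast_sub (by omega)]; simp
  have hs2 : ((q - 1 - s - 1 : ℕ) : ℝ) = q - s - 2 := by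
    rw [Nat.sub_sub, Nat.sub_sub, Nat.cast_sub (by omega)]; push_cast; ring
  have hp1 : (0 : ℝ) < s - 1 := by
    rw [← hs1]; exact_mod_cast (by omega : 0 < s - 1)
  have hp2 : (0 : ℝ) < q - s - 2 := by
    rw [← hs2]; exact_mod_cast (by omega : 0 < q - 1 - s - 1)
  have ht : (v + τ) / q = (s + τ) / q + (v / q : ℤ) := by
    rw [hv]; field_simp; ring
  have key : ∀ w : ℝ, 0 < w → w ≤ s - 1 → w ≤ q - s - 2 →
      distKernel M ((v + τ) / q) ≤ q / 2 * w⁻¹ := by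
    intro w hw hw1 hw2
    have hdist : w / q ≤ ‖(((v + τ) / q : ℝ) : UnitAddCircle)‖ := by
      rw [ht, norm_unitAddCircle_add_int]
      apply le_norm_unitAddCircle
      · gcongr; linarith
      · rw [le_sub_iff_add_le, ← add_div, div_le_one hq']
        linarith
    refine (distKernel_le_of_le (by positivity) hdist).trans (le_of_eq ?_)
    field_simp
  rw [hs1] at e1 ⊢
  rw [hs2] at e2 ⊢
  rcases le_total ((s : ℝ) - 1) (q - s - 2) with h | h
  · have := key _ hp1 le_rfl h
    linarith
  · have := key _ hp2 h le_rfl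
    linarith

lemma sum_range_inv_pred_le (q : ℕ) (hq : 0 < q) :
    ∑ s ∈ range q, (((s - 1 : ℕ) : ℝ))⁻¹ ≤ 1 + Real.log q := by
  have h := harmonic_le_one_add_log q
  refine le_trans ?_ h
  rw [harmonic]
  push_cast
  obtain ⟨q, rfl⟩ : ∃ q', q = q' + 1 := ⟨q - 1, by omega⟩
  rw [sum_range_succ', sum_range_succ]
  simp only [Nat.add_sub_cancel, zero_tsub, Nat.cast_zero, inv_zero, add_zero]
  have : ∑ s ∈ range q, ((s : ℝ))⁻¹ ≤ ∑ x ∈ range q, ((x : ℝ) + 1)⁻¹ := by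
    cases q with
    | zero => simp
    | succ q =>
      rw [sum_range_succ', sum_range_succ]
      simp only [Nat.cast_zero, inv_zero, add_zero]
      push_cast
      have : (0 : ℝ) ≤ ((q : ℝ) + 1)⁻¹ := by positivity
      linarith
  have h2 : (0 : ℝ) ≤ ((q : ℝ) + 1)⁻¹ := by positivity
  linarith

lemma sum_residueMajorant_le {M : ℝ} (hM : 0 < M) {q : ℕ} (hq : 0 < q) :
    ∑ s ∈ range q, residueMajorant M q s ≤ 4 * M + q * (1 + Real.log q) := by
  unfold residueMajorant
  have h1 : ∑ s ∈ range q, (if s < 2 then M else 0) ≤ 2 * M := by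
    rw [← sum_filter, sum_const, nsmul_eq_mul]
    have : #{s ∈ range q | s < 2} ≤ #(range 2) := card_le_card fun s => by simp
    have : (#{s ∈ range q | s < 2} : ℝ) ≤ 2 := by exact_mod_cast (by simpa using this)
    gcongr
  have h2 : ∑ s ∈ range q, (if q ≤ s + 2 then M else 0) ≤ 2 * M := by
    rw [← sum_filter, sum_const, nsmul_eq_mul]
    have : #{s ∈ range q | q ≤ s + 2} ≤ #(Ico (q - 2) q) := card_le_card fun s => by
      simp only [mem_filter, mem_range, mem_Ico]; omega
    rw [Nat.card_Ico] at this
    have : (#{s ∈ range q | q ≤ s + 2} : ℝ) ≤ 2 := by exact_mod_cast (by omega)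
    gcongr
  have h3 := sum_range_inv_pred_le q hq
  have h4 := sum_range_reflect (fun s => (((s - 1 : ℕ) : ℝ))⁻¹) q
  rw [sum_add_distrib, sum_add_distrib, sum_add_distrib, ← mul_sum, ← mul_sum, h4]
  have hq' : (0 : ℝ) < q := by exact_mod_cast hq
  nlinarith

/-! ### Averages over multiples of α, from the approximation a/q. -/

section Approximation

variable {α : ℝ} {a q : ℕ}

/-- Since `a` is prime to `q`, the residues `c + a r` for `q` consecutive `r` are distinct, so each
value of the majorant occurs at most once. -/
lemma sum_block_distKernel_le {M : ℝ} (hM : 0 < M) (hq : 0 < q) (haq : Nat.Coprime a q)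
    (hα : |α - (a : ℝ) / q| ≤ 1 / (q : ℝ) ^ 2) (l₀ : ℕ) :
    ∑ r ∈ range q, distKernel M (α * ((l₀ + r : ℕ) : ℝ)) ≤ 4 * M + q * (1 + Real.log q) := by
  have hq' : (0 : ℝ) < q := by exact_mod_cast hq
  set c : ℤ := ⌊q * (α * l₀)⌋ with hc
  set s : ℕ → ℕ := fun r => ((c + a * r) % q).toNat with hs
  have hinj : Set.InjOn s (range q) := by
    intro r hr r' hr' h
    simp only [coe_range, Set.mem_Iio] at hr hr'
    have h1 : (c + a * r) % q = (c + a * r') % q := by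
      have p1 := Int.emod_nonneg (c + a * r) (by omega : (q : ℤ) ≠ 0)
      have p2 := Int.emod_nonneg (c + a * r') (by omega : (q : ℤ) ≠ 0)
      simp only [hs] at h
      omega
    have h2 : (a * r : ℤ) ≡ a * r' [ZMOD q] := Int.ModEq.add_left_cancel' c h1
    have h3 : a * r ≡ a * r' [MOD q] := by
      rw [← Int.natCast_modEq_iff]; exact_mod_cast h2
    have h4 : r ≡ r' [MOD q] := Nat.ModEq.cancel_left_of_coprime (by rwa [Nat.gcd_comm]) h3
    rwa [Nat.ModEq, Nat.mod_eq_of_lt hr, Nat.mod_eq_of_lt hr'] at h4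
  have hterm : ∀ r ∈ range q, distKernel M (α * ((l₀ + r : ℕ) : ℝ)) ≤ residueMajorant M q (s r) := by
    intro r hr
    have hr : (r : ℝ) ≤ q := by exact_mod_cast (mem_range.mp hr).le
    -- The shift is a fractional part in [0, 1) plus a drift of absolute value at most 1, hence the
    -- window [-1, 2] for τ.
    have e1 : α * ((l₀ + r : ℕ) : ℝ)
        = (((c + a * r : ℤ) : ℝ) + (Int.fract (q * (α * l₀)) + q * r * (α - a / q))) / q := by
      rw [Int.fract, ← hc]
      push_cast
      field_simp
      ring
    have b : |q * r * (α - a / q)| ≤ 1 := by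
      rw [abs_mul, abs_of_nonneg (by positivity)]
      calc (q * r : ℝ) * |α - a / q| ≤ (q * q) * (1 / (q : ℝ) ^ 2) := by gcongr
        _ = 1 := by field_simp
    rw [e1]
    have f0 := Int.fract_nonneg (q * (α * l₀))
    have f1 := Int.fract_lt_one (q * (α * l₀))
    have := abs_le.mp b
    exact distKernel_le_residueMajorant hM hq _ (by linarith) (by linarith)
  refine (sum_le_sum hterm).trans ?_
  rw [← sum_image (f := residueMajorant M q) hinj]
  refine le_trans (sum_le_sum_of_subset_of_nonneg ?_ ?_) (sum_residueMajorant_le hM hq)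
  · intro t
    simp only [mem_image, mem_range]
    rintro ⟨r, _, rfl⟩
    have p1 := Int.emod_nonneg (c + a * r) (by omega : (q : ℤ) ≠ 0)
    have p2 := Int.emod_lt_of_pos (c + a * r) (by omega : (0 : ℤ) < q)
    simp only [hs]
    omega
  · intro t _ _
    exact residueMajorant_nonneg hM q t

lemma sum_distKernel_le {M : ℝ} (hM : 0 < M) (hq : 0 < q) (haq : Nat.Coprime a q)
    (hα : |α - (a : ℝ) / q| ≤ 1 / (q : ℝ) ^ 2) (D : ℕ) :
    ∑ l ∈ Ioc 0 D, distKernel M (α * l) ≤ ((D : ℝ) / q + 1) * (4 * M + q * (1 + Real.log q)) := by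
  have hq' : (0 : ℝ) < q := by exact_mod_cast hq
  have hB : 0 ≤ 4 * M + q * (1 + Real.log q) := by
    have := Real.log_natCast_nonneg q
    positivity
  have h1 : ∀ J : ℕ, ∑ l ∈ range (q * J), distKernel M (α * ((1 + l : ℕ) : ℝ))
      ≤ J * (4 * M + q * (1 + Real.log q)) := by
    intro J
    induction J with
    | zero => simp
    | succ J ih =>
      rw [mul_add, mul_one, sum_range_add]
      have := sum_block_distKernel_le hM hq haq hα (1 + q * J)
      push_cast at this ih ⊢
      simp only [add_assoc] at this ih ⊢
      linarith
  have h2 : ∑ l ∈ Ioc 0 D, distKernel M (α * l)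
      ≤ ∑ l ∈ range (q * (D / q + 1)), distKernel M (α * ((1 + l : ℕ) : ℝ)) := by
    have hD : D ≤ q * (D / q + 1) := (Nat.lt_mul_div_succ D hq).le
    have : ∑ l ∈ Ioc 0 D, distKernel M (α * l)
        = ∑ l ∈ range D, distKernel M (α * ((1 + l : ℕ) : ℝ)) := by
      have hIoc : Ioc 0 D = Ico 1 (D + 1) := by
        ext l; simp only [mem_Ioc, mem_Ico]; omega
      rw [hIoc, sum_Ico_eq_sum_range, Nat.add_sub_cancel]
    rw [this]
    apply sum_le_sum_of_subset_of_nonneg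
    · exact range_subset_range.mpr hD
    · intros; exact distKernel_nonneg hM _
  refine h2.trans ((h1 _).trans ?_)
  gcongr
  push_cast
  gcongr
  exact Nat.cast_div_le

/-- The sum over the multiples of `h` of a nonnegative kernel. -/
lemma sum_distKernel_mul_le {M : ℝ} (hM : 0 < M) (hq : 0 < q) (haq : Nat.Coprime a q)
    (hα : |α - (a : ℝ) / q| ≤ 1 / (q : ℝ) ^ 2) {h : ℕ} (hh : 0 < h) (D : ℕ) :
    ∑ d ∈ Ioc 0 D, distKernel M (α * h * d)
      ≤ (((h * D : ℕ) : ℝ) / q + 1) * (4 * M + q * (1 + Real.log q)) := by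
  refine le_trans ?_ (sum_distKernel_le hM hq haq hα (h * D))
  have : ∑ d ∈ Ioc 0 D, distKernel M (α * h * d)
      = ∑ l ∈ (Ioc 0 D).image (fun d => h * d), distKernel M (α * l) := by
    rw [sum_image]
    · refine sum_congr rfl fun d _ => ?_
      push_cast
      rw [mul_assoc]
    · intro d _ d' _ hd
      exact Nat.eq_of_mul_eq_mul_left hh hd
  rw [this]
  apply sum_le_sum_of_subset_of_nonneg
  · intro l
    simp only [mem_image, mem_Ioc]
    rintro ⟨d, ⟨h1, h2⟩, rfl⟩
    exact ⟨by positivity, Nat.mul_le_mul_left _ h2⟩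
  · intros; exact distKernel_nonneg hM _

/-- Below `q / 2` the multiples of `α` stay at distance `1 / (2 q)` from the integers. -/
lemma norm_mul_ge (hq : 0 < q) (haq : Nat.Coprime a q)
    (hα : |α - (a : ℝ) / q| ≤ 1 / (q : ℝ) ^ 2) {l : ℕ} (hl : 0 < l) (hl2 : 2 * l ≤ q) :
    1 / (2 * q) ≤ ‖((α * l : ℝ) : UnitAddCircle)‖ := by
  have hq' : (0 : ℝ) < q := by exact_mod_cast hq
  rw [UnitAddCircle.norm_eq]
  set n := round (α * l)
  -- As `q` does not divide `a * l`, the rational point is at least 1/q from any integer; replacing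
  -- a/q by α costs at most half of that.
  have h1 : (1 : ℝ) / q ≤ |(a : ℝ) / q * l - n| := by
    have hne : (a * l - n * q : ℤ) ≠ 0 := by
      intro h0
      have hd : (q : ℤ) ∣ a * l := ⟨n, by linarith⟩
      have hd' : q ∣ a * l := by exact_mod_cast hd
      have := Nat.le_of_dvd hl ((Nat.Coprime.symm haq).dvd_of_dvd_mul_left hd')
      omega
    have h2 : (1 : ℝ) ≤ |((a * l - n * q : ℤ) : ℝ)| := by
      rw [← Int.cast_abs]
      exact_mod_cast Int.one_le_abs hne
    have h3 : (a : ℝ) / q * l - n = ((a * l - n * q : ℤ) : ℝ) / q := by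
      push_cast; field_simp
    rw [h3, abs_div, abs_of_pos hq']
    gcongr
  have h2 : |(α - a / q) * l| ≤ 1 / (2 * q) := by
    rw [abs_mul, abs_of_nonneg (by positivity : (0 : ℝ) ≤ l)]
    have hl2' : (l : ℝ) ≤ q / 2 := by
      rw [le_div_iff₀ (by norm_num)]
      exact_mod_cast (by omega)
    calc |α - a / q| * l ≤ 1 / (q : ℝ) ^ 2 * (q / 2) := by gcongr
      _ = 1 / (2 * q) := by field_simp
  have h3 : (a : ℝ) / q * l - n = (α * l - n) - (α - a / q) * l := by ring
  have h4 : |(a : ℝ) / q * l - n| ≤ |α * l - n| + |(α - a / q) * l| := by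
    rw [h3]; exact abs_sub _ _
  have h5 : (1 : ℝ) / q = 1 / (2 * q) + 1 / (2 * q) := by field_simp; norm_num
  linarith

end Approximation

/-! ### Bilinear sums, with a maximum over inner intervals. -/

/-- Total energy of `f` over the dyadic blocks of `(0, 2 ^ K]`. -/
noncomputable def dyadicEnergy (f : ℕ → ℂ) (K : ℕ) : ℝ :=
  ∑ j ∈ range K, ∑ i ∈ range (2 ^ (K - j)), ‖∑ n ∈ Ioc (i * 2 ^ j) ((i + 1) * 2 ^ j), f n‖ ^ 2

/-- Clearing the binary digits of `N` from below leads from the whole prefix to the empty one. Each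
step removes at most one dyadic block, and Cauchy–Schwarz over the `K` scales costs a factor `K`.
The right side does not depend on `N`; this is the source of maximality. -/
lemma norm_prefix_sq_le (f : ℕ → ℂ) {K N : ℕ} (hN : N < 2 ^ K) :
    ‖∑ n ∈ Ioc 0 N, f n‖ ^ 2 ≤ K * dyadicEnergy f K := by
  set F : ℕ → ℂ := fun j => ∑ n ∈ Ioc 0 (N / 2 ^ j * 2 ^ j), f n with hF
  have htel : ∑ n ∈ Ioc 0 N, f n = ∑ j ∈ range K, (F j - F (j + 1)) := by
    rw [sum_range_sub']
    simp [hF, Nat.div_eq_of_lt hN]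
  have hterm : ∀ j ∈ range K, ‖F j - F (j + 1)‖ ^ 2 ≤
      ∑ i ∈ range (2 ^ (K - j)), ‖∑ n ∈ Ioc (i * 2 ^ j) ((i + 1) * 2 ^ j), f n‖ ^ 2 := by
    intro j hj
    have hj' : j < K := mem_range.mp hj
    set t := N / 2 ^ j with ht
    have htK : t < 2 ^ (K - j) := by
      rw [ht, Nat.div_lt_iff_lt_mul (by positivity), ← pow_add, Nat.sub_add_cancel hj'.le]
      exact hN
    have h2 : N / 2 ^ (j + 1) * 2 ^ (j + 1) = (t / 2 * 2) * 2 ^ j := by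
      rw [ht, Nat.div_div_eq_div_mul, pow_succ]; ring
    have hdiff : F j - F (j + 1) = ∑ n ∈ Ioc ((t / 2 * 2) * 2 ^ j) (t * 2 ^ j), f n := by
      simp only [hF]
      rw [h2, sub_eq_iff_eq_add, add_comm, sum_Ioc_consecutive]
      · exact Nat.zero_le _
      · exact Nat.mul_le_mul_right _ (Nat.div_mul_le_self _ _)
    rw [hdiff]
    -- An even `t` removes nothing; an odd `t = 2u + 1` removes the single block of index `2u`.
    rcases Nat.even_or_odd' t with ⟨u, hu | hu⟩
    · have : t / 2 * 2 = t := by omega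
      rw [this]
      simp only [Ioc_self, sum_empty, norm_zero, ne_eq, OfNat.ofNat_ne_zero, not_false_eq_true,
        zero_pow]
      positivity
    · have h3 : t / 2 * 2 = 2 * u := by omega
      rw [h3, hu]
      exact single_le_sum (f := fun i => ‖∑ n ∈ Ioc (i * 2 ^ j) ((i + 1) * 2 ^ j), f n‖ ^ 2)
        (fun i _ => by positivity) (mem_range.mpr (by omega))
  rw [htel]
  calc ‖∑ j ∈ range K, (F j - F (j + 1))‖ ^ 2
      ≤ (∑ j ∈ range K, ‖F j - F (j + 1)‖) ^ 2 := by
        gcongr; exact norm_sum_le _ _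
    _ ≤ #(range K) * ∑ j ∈ range K, ‖F j - F (j + 1)‖ ^ 2 := sq_sum_le_card_mul_sum_sq
    _ ≤ K * dyadicEnergy f K := by
        rw [card_range]
        gcongr
        exact sum_le_sum hterm

lemma dyadicEnergy_nonneg (f : ℕ → ℂ) (K : ℕ) : 0 ≤ dyadicEnergy f K := by
  unfold dyadicEnergy; positivity

lemma norm_interval_sq_le (f : ℕ → ℂ) {K A B : ℕ} (hB : B < 2 ^ K) :
    ‖∑ n ∈ Ioc A B, f n‖ ^ 2 ≤ 4 * K * dyadicEnergy f K := by
  rcases le_or_gt A B with h | h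
  · have h1 := norm_prefix_sq_le f (lt_of_le_of_lt h hB)
    have h2 := norm_prefix_sq_le f hB
    have h3 : ∑ n ∈ Ioc A B, f n = ∑ n ∈ Ioc 0 B, f n - ∑ n ∈ Ioc 0 A, f n := by
      rw [eq_sub_iff_add_eq, add_comm, sum_Ioc_consecutive _ (Nat.zero_le _) h]
    rw [h3]
    have h4 := norm_sub_le (∑ n ∈ Ioc 0 B, f n) (∑ n ∈ Ioc 0 A, f n)
    have h5 : ‖∑ n ∈ Ioc 0 B, f n - ∑ n ∈ Ioc 0 A, f n‖ ^ 2
        ≤ (‖∑ n ∈ Ioc 0 B, f n‖ + ‖∑ n ∈ Ioc 0 A, f n‖) ^ 2 := by gcongr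
    nlinarith [sq_nonneg (‖∑ n ∈ Ioc 0 B, f n‖ - ‖∑ n ∈ Ioc 0 A, f n‖)]
  · rw [Ioc_eq_empty_of_le h.le]
    have := dyadicEnergy_nonneg f K
    simp only [sum_empty, norm_zero, ne_eq, OfNat.ofNat_ne_zero, not_false_eq_true, zero_pow]
    positivity

/-- The differences of each sign take every value up to `B` at most once, the kernel is even, and
the diagonal term is at most `M`. -/
lemma sum_distKernel_sub_le (γ : ℝ) {M : ℕ} (hM : 0 < M) {A B n : ℕ} (hn : n ∈ Ioc A (A + B)) :
    ∑ n' ∈ Ioc A (A + B), distKernel M (γ * ((n : ℝ) - n'))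
      ≤ M + 2 * ∑ d ∈ Ioc 0 B, distKernel M (γ * d) := by
  have hM' : (0 : ℝ) < M := by exact_mod_cast hM
  rw [mem_Ioc] at hn
  have hlow : ∑ n' ∈ Ioc A (n - 1), distKernel M (γ * ((n : ℝ) - n'))
      ≤ ∑ d ∈ Ioc 0 B, distKernel M (γ * d) := by
    have : ∑ n' ∈ Ioc A (n - 1), distKernel M (γ * ((n : ℝ) - n'))
        = ∑ d ∈ (Ioc A (n - 1)).image (fun n' => n - n'), distKernel M (γ * d) := by
      rw [sum_image]
      · refine sum_congr rfl fun n' h => ?_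
        rw [mem_Ioc] at h
        rw [Nat.cast_sub (by omega)]
      · intro x hx y hy hxy
        simp only [coe_Ioc, Set.mem_Ioc] at hx hy hxy
        omega
    rw [this]
    apply sum_le_sum_of_subset_of_nonneg
    · intro d
      simp only [mem_image, mem_Ioc]
      rintro ⟨n', h, rfl⟩
      omega
    · intros; exact distKernel_nonneg hM' _
  have hhigh : ∑ n' ∈ Ioc n (A + B), distKernel M (γ * ((n : ℝ) - n'))
      ≤ ∑ d ∈ Ioc 0 B, distKernel M (γ * d) := by
    have : ∑ n' ∈ Ioc n (A + B), distKernel M (γ * ((n : ℝ) - n'))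
        = ∑ d ∈ (Ioc n (A + B)).image (fun n' => n' - n), distKernel M (γ * d) := by
      rw [sum_image]
      · refine sum_congr rfl fun n' h => ?_
        rw [mem_Ioc] at h
        rw [Nat.cast_sub (by omega), ← distKernel_neg]
        congr 1
        ring
      · intro x hx y hy hxy
        simp only [coe_Ioc, Set.mem_Ioc] at hx hy hxy
        omega
    rw [this]
    apply sum_le_sum_of_subset_of_nonneg
    · intro d
      simp only [mem_image, mem_Ioc]
      rintro ⟨n', h, rfl⟩
      omega
    · intros; exact distKernel_nonneg hM' _
  have hsplit : ∑ n' ∈ Ioc A (A + B), distKernel M (γ * ((n : ℝ) - n'))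
      = ∑ n' ∈ Ioc A (n - 1), distKernel M (γ * ((n : ℝ) - n')) + distKernel M (γ * ((n : ℝ) - n))
        + ∑ n' ∈ Ioc n (A + B), distKernel M (γ * ((n : ℝ) - n')) := by
    rw [← sum_Ioc_consecutive _ hn.1.le hn.2]
    congr 1
    obtain ⟨n, rfl⟩ : ∃ n', n = n' + 1 := ⟨n - 1, by omega⟩
    rw [sum_Ioc_succ_top (by omega)]
    simp
  have := distKernel_le hM' (γ * ((n : ℝ) - n))
  linarith

/-- Expand the square and sum over `l` first: a geometric sum of frequency γ(n - n') remains. This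
needs an inner interval independent of `l`; dyadic blocks remove that restriction afterwards. -/
lemma sum_norm_block_sq_le (γ : ℝ) {c : ℕ → ℂ} (hc : ∀ n, ‖c n‖ ≤ 1) {M : ℕ} (hM : 0 < M)
    (A B : ℕ) :
    ∑ l ∈ Ioc M (2 * M), ‖∑ n ∈ Ioc A (A + B), c n * e (γ * l * n)‖ ^ 2
      ≤ B * (M + 2 * ∑ d ∈ Ioc 0 B, distKernel M (γ * d)) := by
  have hM' : (0 : ℝ) < M := by exact_mod_cast hM
  have hexp : ((∑ l ∈ Ioc M (2 * M), ‖∑ n ∈ Ioc A (A + B), c n * e (γ * l * n)‖ ^ 2 : ℝ) : ℂ)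
      = ∑ n ∈ Ioc A (A + B), ∑ n' ∈ Ioc A (A + B), c n * (starRingEnd ℂ) (c n') *
          ∑ l ∈ Ioc M (2 * M), e (γ * ((n : ℝ) - n') * l) := by
    push_cast
    simp_rw [← Complex.mul_conj', map_sum, sum_mul_sum, mul_sum]
    rw [sum_comm]
    refine sum_congr rfl fun n _ => ?_
    rw [sum_comm]
    refine sum_congr rfl fun n' _ => ?_
    refine sum_congr rfl fun l _ => ?_
    rw [map_mul, conj_e]
    have : γ * ((n : ℝ) - n') * l = γ * l * n + -(γ * l * n') := by ring
    rw [this, e_add]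
    ring
  have hnn : 0 ≤ ∑ l ∈ Ioc M (2 * M), ‖∑ n ∈ Ioc A (A + B), c n * e (γ * l * n)‖ ^ 2 := by
    positivity
  rw [← abs_of_nonneg hnn, ← Real.norm_eq_abs, ← Complex.norm_real, hexp]
  calc _ ≤ ∑ n ∈ Ioc A (A + B), ∑ n' ∈ Ioc A (A + B), distKernel M (γ * ((n : ℝ) - n')) := by
        refine (norm_sum_le _ _).trans (sum_le_sum fun n _ => ?_)
        refine (norm_sum_le _ _).trans (sum_le_sum fun n' _ => ?_)
        rw [norm_mul, norm_mul, RCLike.norm_conj]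
        have h1 := norm_sum_e_le_distKernel (γ * ((n : ℝ) - n')) hM
        calc _ ≤ 1 * 1 * distKernel M (γ * ((n : ℝ) - n')) := by
              gcongr
              · exact hc n
              · exact hc n'
          _ = _ := by ring
    _ ≤ ∑ n ∈ Ioc A (A + B), ((M : ℝ) + 2 * ∑ d ∈ Ioc (0 : ℕ) B, distKernel M (γ * d)) :=
        sum_le_sum fun n hn => sum_distKernel_sub_le γ hM hn
    _ = _ := by
        rw [sum_const, Nat.card_Ioc, nsmul_eq_mul, Nat.add_sub_cancel_left]

/-- Maximal bilinear estimate: the inner interval may depend on the outer variable. -/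
lemma sum_norm_interval_sq_le (γ : ℝ) {c : ℕ → ℂ} (hc : ∀ n, ‖c n‖ ≤ 1) {M K : ℕ} (hM : 0 < M)
    (A B : ℕ → ℕ) (hB : ∀ l ∈ Ioc M (2 * M), B l < 2 ^ K) :
    ∑ l ∈ Ioc M (2 * M), ‖∑ n ∈ Ioc (A l) (B l), c n * e (γ * l * n)‖ ^ 2
      ≤ 4 * K ^ 2 * 2 ^ K * (M + 2 * ∑ d ∈ Ioc (0 : ℕ) (2 ^ K), distKernel M (γ * d)) := by
  have hM' : (0 : ℝ) < M := by exact_mod_cast hM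
  set T := (M : ℝ) + 2 * ∑ d ∈ Ioc (0 : ℕ) (2 ^ K), distKernel M (γ * d) with hT
  have h1 : ∑ l ∈ Ioc M (2 * M), dyadicEnergy (fun n => c n * e (γ * l * n)) K
      ≤ K * (2 ^ K * T) := by
    unfold dyadicEnergy
    rw [sum_comm]
    calc _ ≤ ∑ j ∈ range K, 2 ^ K * T := by
          refine sum_le_sum fun j hj => ?_
          have hj' : j < K := mem_range.mp hj
          rw [sum_comm]
          calc _ ≤ ∑ i ∈ range (2 ^ (K - j)), 2 ^ j * T := by
                refine sum_le_sum fun i _ => ?_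
                have := sum_norm_block_sq_le γ hc hM (i * 2 ^ j) (2 ^ j)
                rw [add_mul, one_mul]
                refine this.trans ?_
                push_cast
                rw [hT]
                have hsum : ∑ d ∈ Ioc (0 : ℕ) (2 ^ j), distKernel M (γ * d)
                    ≤ ∑ d ∈ Ioc (0 : ℕ) (2 ^ K), distKernel M (γ * d) := by
                  apply sum_le_sum_of_subset_of_nonneg
                  · exact Ioc_subset_Ioc_right (Nat.pow_le_pow_right (by norm_num) hj'.le)
                  · intros; exact distKernel_nonneg hM' _
                gcongr
            _ = 2 ^ K * T := by
                rw [sum_const, card_range, nsmul_eq_mul]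
                push_cast
                rw [← mul_assoc, ← pow_add, Nat.sub_add_cancel hj'.le]
      _ = K * (2 ^ K * T) := by
          rw [sum_const, card_range, nsmul_eq_mul]
  calc _ ≤ ∑ l ∈ Ioc M (2 * M), 4 * K * dyadicEnergy (fun n => c n * e (γ * l * n)) K :=
        sum_le_sum fun l hl => norm_interval_sq_le (fun n => c n * e (γ * l * n)) (hB l hl)
    _ = 4 * K * ∑ l ∈ Ioc M (2 * M), dyadicEnergy (fun n => c n * e (γ * l * n)) K := by
        rw [mul_sum]
    _ ≤ 4 * K * (K * (2 ^ K * T)) := by gcongr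
    _ = _ := by ring

/-! ### Divisor sums and the ternary divisor function. -/

lemma sum_divisors_eq_sum_sum {A : Type*} [AddCommMonoid A] (F : ℕ → ℕ → A) (X : ℕ) :
    ∑ l ∈ Ioc 0 X, ∑ d ∈ l.divisors, F d (l / d) = ∑ d ∈ Ioc 0 X, ∑ b ∈ Ioc 0 (X / d), F d b := by
  rw [sum_sigma', sum_sigma']
  refine sum_bij' (fun x _ => ⟨x.2, x.1 / x.2⟩) (fun x _ => ⟨x.1 * x.2, x.1⟩) ?_ ?_ ?_ ?_ ?_
  · rintro ⟨l, d⟩ h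
    simp only [mem_sigma, mem_Ioc, Nat.mem_divisors] at h ⊢
    obtain ⟨⟨h1, h2⟩, ⟨b, rfl⟩, h3⟩ := h
    have hd : 0 < d := Nat.pos_of_mul_pos_right h1
    have hb : 0 < b := Nat.pos_of_mul_pos_left h1
    rw [Nat.mul_div_cancel_left _ hd, Nat.le_div_iff_mul_le hd, mul_comm b]
    exact ⟨⟨hd, (Nat.le_mul_of_pos_right d hb).trans h2⟩, hb, h2⟩
  · rintro ⟨d, b⟩ h
    simp only [mem_sigma, mem_Ioc, Nat.mem_divisors] at h ⊢
    obtain ⟨⟨h1, h2⟩, h3, h4⟩ := h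
    rw [Nat.le_div_iff_mul_le h1, mul_comm b] at h4
    exact ⟨⟨by positivity, h4⟩, Dvd.intro _ rfl, by positivity⟩
  · rintro ⟨l, d⟩ h
    simp only [mem_sigma, mem_Ioc, Nat.mem_divisors] at h ⊢
    rw [Nat.mul_div_cancel' h.2.1]
  · rintro ⟨d, b⟩ h
    simp only [mem_sigma, mem_Ioc] at h ⊢
    rw [Nat.mul_div_cancel_left _ h.1.1]
  · rintro ⟨l, d⟩ h
    rfl

/-- The ternary divisor function. -/
def ternaryDivisor (n : ℕ) : ℝ := ∑ d ∈ n.divisors, (#d.divisors : ℝ)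

lemma ternaryDivisor_nonneg (n : ℕ) : 0 ≤ ternaryDivisor n := by
  unfold ternaryDivisor; positivity

lemma one_le_ternaryDivisor {n : ℕ} (hn : 0 < n) : 1 ≤ ternaryDivisor n := by
  have h : ((#(Nat.divisors 1) : ℕ) : ℝ) ≤ ternaryDivisor n :=
    single_le_sum (f := fun d : ℕ => (#d.divisors : ℝ)) (fun i _ => by positivity)
      (Nat.one_mem_divisors.mpr hn.ne')
  simpa using h

lemma sum_divisors_mul_le {f : ℕ → ℝ} (hf : ∀ n, 0 ≤ f n) (a b : ℕ) :
    ∑ d ∈ (a * b).divisors, f d ≤ ∑ c ∈ a.divisors, ∑ d ∈ b.divisors, f (c * d) := by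
  open scoped Pointwise in
  rw [Nat.divisors_mul, Finset.mul_def, ← sum_product' (f := fun c d => f (c * d))]
  exact sum_image_le_of_nonneg (fun i _ => hf _)

lemma card_divisors_mul_le (a b : ℕ) :
    (#(a * b).divisors : ℝ) ≤ #a.divisors * #b.divisors := by
  have := sum_divisors_mul_le (f := fun _ => (1 : ℝ)) (fun _ => by norm_num) a b
  simpa using this

lemma ternaryDivisor_mul_le (a b : ℕ) :
    ternaryDivisor (a * b) ≤ ternaryDivisor a * ternaryDivisor b := by
  unfold ternaryDivisor
  refine (sum_divisors_mul_le (fun _ => by positivity) a b).trans ?_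
  rw [sum_mul_sum]
  exact sum_le_sum fun c _ => sum_le_sum fun d _ => card_divisors_mul_le c d

/-- With l = db the weight 1/l splits as (1/d)(1/b); dropping the constraint db ≤ X lets the double
sum factor. -/
lemma sum_convolution_div_le {u v : ℕ → ℝ} (hu : ∀ n, 0 ≤ u n) (hv : ∀ n, 0 ≤ v n) (X : ℕ) :
    ∑ l ∈ Ioc 0 X, (∑ d ∈ l.divisors, u d * v (l / d)) / l
      ≤ (∑ d ∈ Ioc 0 X, u d / d) * ∑ b ∈ Ioc 0 X, v b / b := by
  have h1 : ∑ l ∈ Ioc 0 X, (∑ d ∈ l.divisors, u d * v (l / d)) / l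
      = ∑ l ∈ Ioc 0 X, ∑ d ∈ l.divisors, (u d / d) * (v (l / d) / (l / d : ℕ)) := by
    refine sum_congr rfl fun l hl => ?_
    rw [sum_div]
    refine sum_congr rfl fun d hd => ?_
    rw [Nat.mem_divisors] at hd
    obtain ⟨⟨b, rfl⟩, h⟩ := hd
    have hd0 : d ≠ 0 := fun h0 => h (by simp [h0])
    have hb0 : b ≠ 0 := fun h0 => h (by simp [h0])
    rw [Nat.mul_div_cancel_left _ (Nat.pos_of_ne_zero hd0)]
    push_cast
    field_simp
  rw [h1, sum_divisors_eq_sum_sum (fun d b => (u d / d) * (v b / b)), sum_mul_sum]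
  refine sum_le_sum fun d _ => ?_
  apply sum_le_sum_of_subset_of_nonneg
  · exact Ioc_subset_Ioc_right (Nat.div_le_self _ _)
  · intro b _ _
    exact mul_nonneg (div_nonneg (hu _) (by positivity)) (div_nonneg (hv _) (by positivity))

lemma sum_inv_le (X : ℕ) : ∑ d ∈ Ioc 0 X, (1 : ℝ) / d ≤ 1 + Real.log X := by
  refine le_trans (le_of_eq ?_) (harmonic_le_one_add_log X)
  have hIoc : Ioc 0 X = Ico 1 (X + 1) := by
    ext l; simp only [mem_Ioc, mem_Ico]; omega
  rw [harmonic, hIoc, sum_Ico_eq_sum_range, Nat.add_sub_cancel]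
  push_cast
  exact sum_congr rfl fun i _ => by rw [one_div, add_comm]

lemma sum_card_divisors_div_le (X : ℕ) :
    ∑ l ∈ Ioc 0 X, (#l.divisors : ℝ) / l ≤ (1 + Real.log X) ^ 2 := by
  have h := sum_convolution_div_le (u := fun _ => 1) (v := fun _ => 1)
    (fun _ => by norm_num) (fun _ => by norm_num) X
  simp only [mul_one, sum_const, nsmul_eq_mul] at h
  refine h.trans ?_
  rw [← sq]
  gcongr
  exact sum_inv_le X

lemma sum_ternaryDivisor_div_le (X : ℕ) :
    ∑ l ∈ Ioc 0 X, ternaryDivisor l / l ≤ (1 + Real.log X) ^ 3 := by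
  have h := sum_convolution_div_le (u := fun d => (#d.divisors : ℝ)) (v := fun _ => 1)
    (fun _ => by positivity) (fun _ => by norm_num) X
  simp only [mul_one] at h
  have h1 := sum_inv_le X
  have h2 := sum_card_divisors_div_le X
  have h3 := Real.log_natCast_nonneg X
  calc _ ≤ _ := h
    _ ≤ (1 + Real.log X) ^ 2 * (1 + Real.log X) := by gcongr
    _ = _ := by ring

/-- One factor τ₃ is opened twice, as ∑ τ(d) and then τ as ∑ 1. By submultiplicativity each opening
splits off a factor ∑ τ₃(b)/b, so three factors (1 + log X)³ result. -/
lemma sum_ternaryDivisor_sq_div_le (X : ℕ) :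
    ∑ l ∈ Ioc 0 X, ternaryDivisor l ^ 2 / l ≤ (1 + Real.log X) ^ 9 := by
  have h3 := Real.log_natCast_nonneg X
  have hT := sum_ternaryDivisor_div_le X
  have hT0 : 0 ≤ ∑ l ∈ Ioc 0 X, ternaryDivisor l / l :=
    sum_nonneg fun l _ => div_nonneg (ternaryDivisor_nonneg l) (by positivity)
  have step : ∀ u : ℕ → ℝ, (∀ n, 0 ≤ u n) →
      ∑ l ∈ Ioc 0 X, (∑ d ∈ l.divisors, u d) * ternaryDivisor l / l
        ≤ (∑ d ∈ Ioc 0 X, u d * ternaryDivisor d / d) * ∑ b ∈ Ioc 0 X, ternaryDivisor b / b := by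
    intro u hu
    refine le_trans (sum_le_sum fun l _ => ?_)
      (sum_convolution_div_le (u := fun d => u d * ternaryDivisor d)
        (fun n => mul_nonneg (hu n) (ternaryDivisor_nonneg n)) ternaryDivisor_nonneg X)
    gcongr
    rw [sum_mul]
    refine sum_le_sum fun d hd => ?_
    rw [mul_assoc]
    apply mul_le_mul_of_nonneg_left _ (hu d)
    have := ternaryDivisor_mul_le d (l / d)
    rwa [Nat.mul_div_cancel' (Nat.dvd_of_mem_divisors hd)] at this
  have s1 := step (fun d => (#d.divisors : ℝ)) (fun _ => by positivity)
  have s2 := step (fun _ => 1) (fun _ => by norm_num)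
  simp only [sum_const, nsmul_eq_mul, mul_one, one_mul] at s2
  calc ∑ l ∈ Ioc 0 X, ternaryDivisor l ^ 2 / l
      = ∑ l ∈ Ioc 0 X, (∑ d ∈ l.divisors, (#d.divisors : ℝ)) * ternaryDivisor l / l := by
        refine sum_congr rfl fun l _ => ?_
        rw [sq]; rfl
    _ ≤ _ := s1
    _ ≤ ((1 + Real.log X) ^ 3 * (1 + Real.log X) ^ 3) * (1 + Real.log X) ^ 3 := by
        gcongr
        exact s2.trans (by gcongr)
    _ = _ := by ring

/-- An integer l = mdb comes from at most τ₃(l) triples, and z < db forces l > z. -/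
lemma sum_triple_le {W : ℕ → ℝ} (hW : ∀ n, 0 ≤ W n) (z Q : ℕ) :
    ∑ m ∈ Ioc 0 z, ∑ d ∈ Ioc 0 z, ∑ b ∈ Ioc 0 (Q / (m * d)) with z < d * b, W (m * d * b)
      ≤ ∑ l ∈ Ioc z Q, ternaryDivisor l * W l := by
  set V : ℕ → ℝ := fun l => if z < l then W l else 0 with hV
  have hV0 : ∀ l, 0 ≤ V l := fun l => by
    simp only [hV]; split_ifs
    · exact hW l
    · exact le_rfl
  set G : ℕ → ℝ := fun n => ∑ b ∈ Ioc 0 (Q / n), V (n * b) with hG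
  have hG0 : ∀ n, 0 ≤ G n := fun n => sum_nonneg fun _ _ => hV0 _
  have hGz : ∀ n, Q < n → G n = 0 := fun n hn => by
    simp only [hG]; rw [Nat.div_eq_of_lt hn]; simp
  have e1 : ∑ l ∈ Ioc z Q, ternaryDivisor l * W l = ∑ l ∈ Ioc 0 Q, ternaryDivisor l * V l := by
    simp only [hV, mul_ite, mul_zero]
    rw [← sum_filter]
    refine sum_congr ?_ fun _ _ => rfl
    ext l
    simp only [mem_Ioc, mem_filter]
    omega
  have e2 : ∑ l ∈ Ioc 0 Q, ternaryDivisor l * V l = ∑ n ∈ Ioc 0 Q, (#n.divisors : ℝ) * G n := by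
    simp only [hG, mul_sum]
    rw [← sum_divisors_eq_sum_sum (fun n b => (#n.divisors : ℝ) * V (n * b))]
    refine sum_congr rfl fun l _ => ?_
    rw [ternaryDivisor, sum_mul]
    refine sum_congr rfl fun d hd => ?_
    rw [Nat.mul_div_cancel' (Nat.dvd_of_mem_divisors hd)]
  have e3 : ∑ n ∈ Ioc 0 Q, (#n.divisors : ℝ) * G n
      = ∑ m ∈ Ioc 0 Q, ∑ d ∈ Ioc 0 (Q / m), G (m * d) := by
    rw [← sum_divisors_eq_sum_sum (fun m d => G (m * d))]
    refine sum_congr rfl fun n _ => ?_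
    rw [← nsmul_eq_mul, ← sum_const]
    refine sum_congr rfl fun d hd => ?_
    rw [Nat.mul_div_cancel' (Nat.dvd_of_mem_divisors hd)]
  rw [e1, e2, e3]
  calc _ ≤ ∑ m ∈ Ioc 0 z, ∑ d ∈ Ioc 0 z, G (m * d) := by
        refine sum_le_sum fun m hm => sum_le_sum fun d _ => ?_
        rw [sum_filter]
        refine sum_le_sum fun b _ => ?_
        rw [mem_Ioc] at hm
        split_ifs with h
        · have : z < m * d * b := by
            rw [mul_assoc]
            exact h.trans_le (Nat.le_mul_of_pos_left _ hm.1)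
          simp [hV, this]
        · exact hV0 _
    _ ≤ ∑ m ∈ Ioc 0 z, ∑ d ∈ Ioc 0 (Q / m), G (m * d) := by
        refine sum_le_sum fun m hm => ?_
        rw [mem_Ioc] at hm
        have h1 : ∑ d ∈ Ioc 0 z, G (m * d) = ∑ d ∈ Ioc 0 z with d ≤ Q / m, G (m * d) := by
          rw [sum_filter]
          refine sum_congr rfl fun d _ => ?_
          split_ifs with h
          · rfl
          · apply hGz
            rw [Nat.le_div_iff_mul_le hm.1, mul_comm] at h
            omega
        rw [h1]
        apply sum_le_sum_of_subset_of_nonneg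
        · intro d
          simp only [mem_filter, mem_Ioc]
          omega
        · intros; exact hG0 _
    _ ≤ ∑ m ∈ Ioc 0 Q, ∑ d ∈ Ioc 0 (Q / m), G (m * d) := by
        have h1 : ∑ m ∈ Ioc 0 z, ∑ d ∈ Ioc 0 (Q / m), G (m * d)
            = ∑ m ∈ Ioc 0 z with m ≤ Q, ∑ d ∈ Ioc 0 (Q / m), G (m * d) := by
          rw [sum_filter]
          refine sum_congr rfl fun m _ => ?_
          split_ifs with h
          · rfl
          · rw [Nat.div_eq_of_lt (by omega)]; simp
        rw [h1]
        apply sum_le_sum_of_subset_of_nonneg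
        · intro d
          simp only [mem_filter, mem_Ioc]
          omega
        · intros; exact sum_nonneg fun _ _ => hG0 _

/-! ### Sums over primes and Rankin's bound. -/

/-- Chebyshev's bound for θ suffices, since log p ≥ j log 2 and p ≥ 2^j throughout the block. -/
lemma sum_inv_primes_dyadic_le {j : ℕ} (hj : 0 < j) :
    ∑ p ∈ Ioc ((2 : ℕ) ^ j) (2 ^ (j + 1)) with p.Prime, (1 : ℝ) / p ≤ 4 / j := by
  have hl2 : 0 < Real.log 2 := Real.log_pos (by norm_num)
  have hj' : (0 : ℝ) < j := by exact_mod_cast hj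
  have hθ := Chebyshev.theta_le_log4_mul_x (x := ((2 ^ (j + 1) : ℕ) : ℝ)) (by positivity)
  rw [Chebyshev.theta, Nat.floor_natCast] at hθ
  have h1 : ∑ p ∈ Ioc ((2 : ℕ) ^ j) (2 ^ (j + 1)) with p.Prime, Real.log p
      ≤ Real.log 4 * ((2 ^ (j + 1) : ℕ) : ℝ) := by
    refine le_trans ?_ hθ
    apply sum_le_sum_of_subset_of_nonneg
    · exact filter_subset_filter _ (Ioc_subset_Ioc_left (Nat.zero_le _))
    · intro p _ _
      exact Real.log_natCast_nonneg p
  have h2 : ∀ p ∈ (Ioc (2 ^ j) (2 ^ (j + 1))).filter Nat.Prime,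
      (1 : ℝ) / p ≤ Real.log p / (2 ^ j * (j * Real.log 2)) := by
    intro p hp
    rw [mem_filter, mem_Ioc] at hp
    have hp1 : ((2 : ℝ) ^ j) ≤ p := by exact_mod_cast hp.1.1.le
    have hp2 : j * Real.log 2 ≤ Real.log p := by
      rw [← Real.log_pow]
      exact Real.log_le_log (by positivity) hp1
    have hp0 : (0 : ℝ) < p := lt_of_lt_of_le (by positivity) hp1
    rw [div_le_div_iff₀ hp0 (by positivity), one_mul, mul_comm]
    gcongr
  refine (sum_le_sum h2).trans ?_
  rw [← sum_div, div_le_div_iff₀ (by positivity) hj']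
  have h4 : Real.log 4 = 2 * Real.log 2 := by
    rw [show (4 : ℝ) = 2 ^ 2 by norm_num, Real.log_pow]; norm_num
  rw [h4] at h1
  push_cast at h1
  calc _ ≤ 2 * Real.log 2 * 2 ^ (j + 1) * j := by gcongr
    _ = _ := by ring

/-- The dyadic bounds 4/j add up to a harmonic sum: an upper bound of Mertens type, losing only a
constant factor on log log. -/
lemma sum_inv_primes_le (J : ℕ) :
    ∑ p ∈ Ioc (0 : ℕ) (2 ^ (J + 1)) with p.Prime, (1 : ℝ) / p ≤ 5 + 4 * Real.log J := by
  have h : ∑ p ∈ Ioc (0 : ℕ) (2 ^ (J + 1)) with p.Prime, (1 : ℝ) / p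
      ≤ 1 + 4 * ∑ j ∈ Ioc 0 J, (1 : ℝ) / j := by
    induction J with
    | zero =>
      have : (Ioc 0 (2 ^ (0 + 1))).filter Nat.Prime = {2} := by decide
      rw [this]; norm_num
    | succ J ih =>
      rw [sum_filter] at ih ⊢
      rw [← sum_Ioc_consecutive _ (Nat.zero_le (2 ^ (J + 1)))
        (Nat.pow_le_pow_right (by norm_num) (by omega : J + 1 ≤ J + 1 + 1)),
        sum_Ioc_succ_top (Nat.zero_le _)]
      have := sum_inv_primes_dyadic_le (j := J + 1) (by omega)
      rw [sum_filter] at this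
      have e : (4 : ℝ) / ((J + 1 : ℕ) : ℝ) = 4 * (1 / ((J + 1 : ℕ) : ℝ)) := by ring
      linarith
  have := sum_inv_le J
  linarith

lemma inv_one_sub_le_exp {t : ℝ} (h0 : 0 ≤ t) (h1 : t ≤ 3 / 4) : (1 - t)⁻¹ ≤ Real.exp (4 * t) := by
  have hpos : 0 < 1 - t := by linarith
  have e1 : (1 - t)⁻¹ = t / (1 - t) + 1 := by field_simp; ring
  rw [e1]
  refine (Real.add_one_le_exp _).trans (Real.exp_le_exp.mpr ?_)
  rw [div_le_iff₀ hpos]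
  nlinarith

/-- Rankin's bound for the number of `y`-smooth integers up to `X`. -/
lemma card_smooth_le_rankin {δ : ℝ} (hδ0 : 0 ≤ δ) (hδ : δ ≤ 1 / 2) (X : ℕ) {y J : ℕ}
    (hy : y ≤ 2 ^ (J + 1)) :
    (#(Nat.smoothNumbersUpTo X (y + 1)) : ℝ)
      ≤ (X : ℝ) ^ (1 - δ) * Real.exp (4 * ((y : ℝ) ^ δ * (5 + 4 * Real.log J))) := by
  set σ := 1 - δ with hσ
  have hσ0 : 0 < σ := by linarith
  let f : ℕ →* ℝ :=
    { toFun := fun n => (n : ℝ) ^ (-σ)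
      map_one' := by simp
      map_mul' := fun a b => by
        push_cast; exact Real.mul_rpow (by positivity) (by positivity) }
  have hf : ∀ n : ℕ, f n = (n : ℝ) ^ (-σ) := fun _ => rfl
  have hf0 : ∀ n : ℕ, 0 ≤ f n := fun n => by rw [hf]; positivity
  -- δ ≤ 1/2 gives f(p) ≤ 2^(-1/2) < 3/4, the range that `inv_one_sub_le_exp` admits.
  have hfp : ∀ {p : ℕ}, p.Prime → f p ≤ 3 / 4 := by
    intro p hp
    rw [hf]
    have h2 : (2 : ℝ) ≤ p := by exact_mod_cast hp.two_le
    calc (p : ℝ) ^ (-σ) ≤ (2 : ℝ) ^ (-σ) :=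
          Real.rpow_le_rpow_of_nonpos (by norm_num) h2 (by linarith)
      _ ≤ (2 : ℝ) ^ (-(1 / 2) : ℝ) :=
          Real.rpow_le_rpow_of_exponent_le (by norm_num) (by linarith)
      _ ≤ 3 / 4 := by
          rw [Real.rpow_neg (by norm_num), ← Real.sqrt_eq_rpow]
          have : (4 : ℝ) / 3 ≤ √2 := Real.le_sqrt_of_sq_le (by norm_num)
          calc (√2)⁻¹ ≤ ((4 : ℝ) / 3)⁻¹ := by gcongr
            _ = 3 / 4 := by norm_num
  have hE := EulerProduct.summable_and_hasSum_smoothNumbers_prod_primesBelow_geometric (f := f)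
    (fun {p} hp => by
      rw [Real.norm_of_nonneg (hf0 p)]
      linarith [hfp hp]) (y + 1)
  have hprod : ∏ p ∈ (y + 1).primesBelow, (1 - f p)⁻¹
      ≤ Real.exp (4 * ((y : ℝ) ^ δ * (5 + 4 * Real.log J))) := by
    calc ∏ p ∈ (y + 1).primesBelow, (1 - f p)⁻¹
        ≤ ∏ p ∈ (y + 1).primesBelow, Real.exp (4 * f p) := by
          refine prod_le_prod (fun p hp => ?_) (fun p hp => ?_)
          · rw [inv_nonneg]
            linarith [hfp (Nat.prime_of_mem_primesBelow hp)]
          · exact inv_one_sub_le_exp (hf0 p) (hfp (Nat.prime_of_mem_primesBelow hp))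
      _ = Real.exp (4 * ∑ p ∈ (y + 1).primesBelow, f p) := by
          rw [← Real.exp_sum, mul_sum]
      _ ≤ _ := by
          gcongr
          calc ∑ p ∈ (y + 1).primesBelow, f p
              ≤ ∑ p ∈ (y + 1).primesBelow, (y : ℝ) ^ δ * (1 / p) := by
                refine sum_le_sum fun p hp => ?_
                have hp0 : 0 < p := (Nat.prime_of_mem_primesBelow hp).pos
                have hpy : p ≤ y := by
                  have := Nat.lt_of_mem_primesBelow hp
                  omega
                have hp0' : (0 : ℝ) < p := by exact_mod_cast hp0
                rw [hf, hσ, show -(1 - δ) = δ + -1 by ring, Real.rpow_add hp0', Real.rpow_neg_one,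
                  one_div]
                gcongr
            _ = (y : ℝ) ^ δ * ∑ p ∈ (y + 1).primesBelow, (1 : ℝ) / p := by rw [mul_sum]
            _ ≤ _ := by
                gcongr
                refine le_trans ?_ (sum_inv_primes_le J)
                apply sum_le_sum_of_subset_of_nonneg
                · intro p hp
                  have h1 := Nat.prime_of_mem_primesBelow hp
                  have h2 := Nat.lt_of_mem_primesBelow hp
                  have h3 := h1.pos
                  simp only [mem_filter, mem_Ioc]
                  exact ⟨⟨h3, by omega⟩, h1⟩
                · intros; positivity
  set S := Nat.smoothNumbersUpTo X (y + 1) with hS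
  have hmem : ∀ n ∈ S, n ∈ Nat.smoothNumbers (y + 1) ∧ n ≤ X := fun n hn => by
    have := (Nat.mem_smoothNumbersUpTo.mp hn)
    exact ⟨this.2, this.1⟩
  have hsum : ∑ n ∈ S, f n ≤ ∏ p ∈ (y + 1).primesBelow, (1 - f p)⁻¹ := by
    have h1 := sum_le_hasSum (S.subtype (· ∈ Nat.smoothNumbers (y + 1)))
      (fun i _ => hf0 i) hE.2
    rwa [sum_subtype_of_mem (f := fun n => f n) (fun n hn => (hmem n hn).1)] at h1
  -- Rankin's trick: every counted n has (X/n)^σ ≥ 1, so the count is dominated by X^σ times an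
  -- Euler product.
  have hone : ∀ n ∈ S, (1 : ℝ) ≤ (X : ℝ) ^ σ * f n := by
    intro n hn
    have hn0 : (0 : ℝ) < n := by
      exact_mod_cast Nat.pos_of_ne_zero (Nat.ne_zero_of_mem_smoothNumbers (hmem n hn).1)
    have hnX : (n : ℝ) ≤ X := by exact_mod_cast (hmem n hn).2
    rw [hf, Real.rpow_neg hn0.le, ← div_eq_mul_inv, one_le_div (by positivity)]
    gcongr
  calc (#S : ℝ) = ∑ n ∈ S, (1 : ℝ) := by simp
    _ ≤ ∑ n ∈ S, (X : ℝ) ^ σ * f n := sum_le_sum hone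
    _ = (X : ℝ) ^ σ * ∑ n ∈ S, f n := by rw [mul_sum]
    _ ≤ _ := by
        gcongr
        exact hsum.trans hprod

/-! ### Splitting off the largest prime factor. -/

/-- No prime factor of `m` exceeds `p`. -/
def PrimeFactorsLE (m p : ℕ) : Prop := ∀ r ∈ m.primeFactors, r ≤ p

instance (m p : ℕ) : Decidable (PrimeFactorsLE m p) :=
  inferInstanceAs (Decidable (∀ _ ∈ m.primeFactors, _))

lemma PrimeFactorsLE.of_le {m p : ℕ} (h : m ≤ p) : PrimeFactorsLE m p :=
  fun _ hr => (Nat.le_of_mem_primeFactors hr).trans h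

/-- The largest prime factor. -/
def largestPrime (n : ℕ) : ℕ := n.primeFactors.sup id

lemma le_largestPrime {n r : ℕ} (hr : r ∈ n.primeFactors) : r ≤ largestPrime n :=
  le_sup (f := id) hr

lemma primeFactorsLE_iff {m p : ℕ} : PrimeFactorsLE m p ↔ largestPrime m ≤ p := by
  unfold PrimeFactorsLE largestPrime
  simp

lemma largestPrime_mem {n : ℕ} (hn : 2 ≤ n) : largestPrime n ∈ n.primeFactors := by
  have hne : n.primeFactors.Nonempty := Nat.nonempty_primeFactors.mpr hn
  obtain ⟨r, hr, h⟩ := exists_mem_eq_sup n.primeFactors hne id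
  unfold largestPrime
  rw [h]
  exact hr

lemma largestPrime_mul {m p : ℕ} (hm : 0 < m) (hp : p.Prime) (h : PrimeFactorsLE m p) :
    largestPrime (m * p) = p := by
  unfold largestPrime
  rw [Nat.primeFactors_mul hm.ne' hp.ne_zero, hp.primeFactors, sup_union, sup_singleton]
  exact sup_eq_right.mpr (primeFactorsLE_iff.mp h)

lemma not_mem_smoothNumbers_iff {n y : ℕ} (hn : 0 < n) :
    n ∉ Nat.smoothNumbers (y + 1) ↔ y < largestPrime n := by
  constructor
  · intro h
    rw [Nat.mem_smoothNumbers'] at h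
    push Not at h
    obtain ⟨p, hp, hpn, hy⟩ := h
    exact lt_of_lt_of_le (by omega)
      (le_largestPrime (Nat.mem_primeFactors.mpr ⟨hp, hpn, hn.ne'⟩))
  · intro h hs
    have hn2 : 2 ≤ n := by
      by_contra hlt
      have : n = 1 := by omega
      subst this
      simp [largestPrime] at h
    have hmem := largestPrime_mem hn2
    have := Nat.mem_smoothNumbers'.mp hs _ (Nat.prime_of_mem_primeFactors hmem)
      (Nat.dvd_of_mem_primeFactors hmem)
    omega

/-- Integers with a prime factor above `y`, parametrized by their largest prime factor. -/
lemma sum_rough_eq {A : Type*} [AddCommMonoid A] (F : ℕ → A) (X y : ℕ) :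
    ∑ n ∈ Ioc 0 X with y < largestPrime n, F n
      = ∑ m ∈ Ioc 0 X, ∑ p ∈ Ioc y (X / m) with p.Prime ∧ PrimeFactorsLE m p, F (m * p) := by
  rw [sum_sigma']
  have hn2 : ∀ n, y < largestPrime n → 0 < n → 2 ≤ n := by
    intro n hn h0
    by_contra hlt
    have : n = 1 := by omega
    subst this
    simp [largestPrime] at hn
  refine sum_bij' (fun n _ => ⟨n / largestPrime n, largestPrime n⟩) (fun x _ => x.1 * x.2)
    ?_ ?_ ?_ ?_ ?_
  · intro n hn
    simp only [mem_filter, mem_Ioc, mem_sigma] at hn ⊢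
    obtain ⟨⟨h0, hX⟩, hy⟩ := hn
    have hmem := largestPrime_mem (hn2 n hy h0)
    have hp := Nat.prime_of_mem_primeFactors hmem
    have hdvd := Nat.dvd_of_mem_primeFactors hmem
    have hq : 0 < n / largestPrime n := Nat.div_pos (Nat.le_of_dvd h0 hdvd) hp.pos
    refine ⟨⟨hq, (Nat.div_le_self _ _).trans hX⟩, ⟨hy, ?_⟩, hp, ?_⟩
    · rw [Nat.le_div_iff_mul_le hq, Nat.mul_div_cancel' hdvd]
      exact hX
    · intro r hr
      exact le_largestPrime (Nat.primeFactors_mono (Nat.div_dvd_of_dvd hdvd) h0.ne' hr)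
  · rintro ⟨m, p⟩ h
    simp only [mem_filter, mem_Ioc, mem_sigma] at h ⊢
    obtain ⟨⟨hm, _⟩, ⟨hy, hpX⟩, hp, hle⟩ := h
    rw [largestPrime_mul hm hp hle]
    rw [Nat.le_div_iff_mul_le hm, mul_comm] at hpX
    exact ⟨⟨Nat.mul_pos hm hp.pos, hpX⟩, hy⟩
  · intro n hn
    simp only [mem_filter, mem_Ioc] at hn
    have hmem := largestPrime_mem (hn2 n hn.2 hn.1.1)
    exact Nat.div_mul_cancel (Nat.dvd_of_mem_primeFactors hmem)
  · rintro ⟨m, p⟩ h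
    simp only [mem_filter, mem_Ioc, mem_sigma] at h
    obtain ⟨⟨hm, _⟩, ⟨hy, hpX⟩, hp, hle⟩ := h
    simp only [largestPrime_mul hm hp hle, Nat.mul_div_cancel _ hp.pos]
  · intro n hn
    simp only [mem_filter, mem_Ioc] at hn
    have hmem := largestPrime_mem (hn2 n hn.2 hn.1.1)
    rw [Nat.div_mul_cancel (Nat.dvd_of_mem_primeFactors hmem)]

lemma filter_not_rough_eq (X y : ℕ) :
    {n ∈ Ioc 0 X | ¬ y < largestPrime n} = Nat.smoothNumbersUpTo X (y + 1) := by
  ext n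
  rw [mem_filter, mem_Ioc, Nat.mem_smoothNumbersUpTo]
  constructor
  · rintro ⟨⟨h0, hX⟩, h⟩
    rw [← not_mem_smoothNumbers_iff h0, not_not] at h
    exact ⟨hX, h⟩
  · rintro ⟨hX, h⟩
    have h0 := Nat.pos_of_ne_zero (Nat.ne_zero_of_mem_smoothNumbers h)
    rw [← not_mem_smoothNumbers_iff h0, not_not]
    exact ⟨⟨h0, hX⟩, h⟩

lemma sum_eq_smooth_add_rough {A : Type*} [AddCommMonoid A] (F : ℕ → A) (X y : ℕ) :
    ∑ n ∈ Ioc 0 X, F n = ∑ n ∈ Nat.smoothNumbersUpTo X (y + 1), F n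
      + ∑ m ∈ Ioc 0 X, ∑ p ∈ Ioc y (X / m) with p.Prime ∧ PrimeFactorsLE m p, F (m * p) := by
  rw [← sum_rough_eq, ← filter_not_rough_eq, add_comm, sum_filter_add_sum_filter_not]

/-! ### Membership in 𝓑 and unions of intervals. -/

lemma primeFactorsList_mul_of_le {m p : ℕ} (hm : 0 < m) (hp : p.Prime)
    (h : PrimeFactorsLE m p) :
    (m * p).primeFactorsList = m.primeFactorsList ++ [p] := by
  have h1 : (m * p).primeFactorsList.Perm (m.primeFactorsList ++ [p]) := by
    have := Nat.perm_primeFactorsList_mul hm.ne' hp.ne_zero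
    rwa [Nat.primeFactorsList_prime hp] at this
  refine h1.eq_of_pairwise' (Nat.primeFactorsList_sorted _).pairwise ?_
  rw [List.pairwise_append]
  refine ⟨(Nat.primeFactorsList_sorted _).pairwise, by simp, fun r hr t ht => ?_⟩
  rw [List.mem_singleton.mp ht]
  exact h r (Nat.mem_primeFactors_iff_mem_primeFactorsList.mpr hr)

/-- Appending `p` to the factor list of `m` leaves the earlier partial products unchanged. Only the
last condition is new, and its partial product is `m` itself. -/
lemma mul_mem_seqB_iff {I : ℕ → Set ℝ} {m p : ℕ} (hm : 0 < m) (hp : p.Prime)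
    (h : PrimeFactorsLE m p) :
    m * p ∈ seqB I ↔ m ∈ seqB I ∧ (p : ℝ) ∈ I m := by
  have hl := primeFactorsList_mul_of_le hm hp h
  have key : ∀ (l : List ℕ) (l' : List ℕ), l' = l ++ [p] →
      ((∀ j : Fin l'.length, ((l'.get j : ℕ) : ℝ) ∈ I ((l'.take j).prod)) ↔
        (∀ j : Fin l.length, ((l.get j : ℕ) : ℝ) ∈ I ((l.take j).prod)) ∧ (p : ℝ) ∈ I l.prod) := by
    rintro l _ rfl
    constructor
    · intro H
      refine ⟨fun j => ?_, ?_⟩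
      · have := H ⟨j, by simp⟩
        simpa [List.getElem_append_left, List.take_append_of_le_length] using this
      · have := H ⟨l.length, by simp⟩
        simpa using this
    · rintro ⟨H1, H2⟩ ⟨j, hj⟩
      rw [List.length_append, List.length_singleton] at hj
      rcases Nat.lt_or_ge j l.length with hj' | hj'
      · have := H1 ⟨j, hj'⟩
        simpa [List.getElem_append_left, List.take_append_of_le_length, hj', hj'.le] using this
      · have : j = l.length := by omega
        subst this
        simpa using H2
  unfold seqB
  rw [Set.mem_ofPred_eq, Set.mem_ofPred_eq, key _ _ hl, Nat.prod_primeFactorsList hm.ne']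
  have : 0 < m * p := Nat.mul_pos hm hp.pos
  tauto

lemma filter_ordConnected_eq {T : Set ℝ} (hT : T.OrdConnected) (A B : ℕ)
    [DecidablePred fun p : ℕ => (p : ℝ) ∈ T] :
    ∃ a b : ℕ, A ≤ a ∧ b ≤ B ∧ {p ∈ Ioc A B | ((p : ℕ) : ℝ) ∈ T} = Ioc a b := by
  set S := {p ∈ Ioc A B | ((p : ℕ) : ℝ) ∈ T} with hS
  rcases S.eq_empty_or_nonempty with h | h
  -- `min A B` keeps the right end at most `B` even when `B < A`.
  · exact ⟨A, min A B, le_rfl, min_le_right _ _, by rw [h, Ioc_eq_empty_of_le (min_le_left _ _)]⟩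
  · have h1 := min'_mem S h
    have h2 := max'_mem S h
    have h1' := mem_filter.mp h1
    have h2' := mem_filter.mp h2
    rw [mem_Ioc] at h1' h2'
    refine ⟨S.min' h - 1, S.max' h, by omega, h2'.1.2, ?_⟩
    ext p
    rw [mem_Ioc]
    constructor
    · intro hp
      have := min'_le S p hp
      have := le_max' S p hp
      omega
    · rintro ⟨p1, p2⟩
      rw [hS, mem_filter, mem_Ioc]
      refine ⟨by omega, hT.out h1'.2 h2'.2 ⟨?_, ?_⟩⟩
      · exact_mod_cast (by omega : S.min' h ≤ p)
      · exact_mod_cast p2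

open Classical in
/-- A bound for sums over intervals gives one for sums over unions of intervals. -/
lemma norm_sum_unionOfIntervals_le (g : ℕ → ℂ) {A B : ℕ} {W : ℝ}
    (hW : ∀ a b, A ≤ a → b ≤ B → ‖∑ p ∈ Ioc a b, g p‖ ≤ W) (k : ℕ) {S : Set ℝ}
    (hS : IsUnionOfIntervals k S) :
    ‖∑ p ∈ Ioc A B with ((p : ℕ) : ℝ) ∈ S, g p‖ ≤ (2 ^ k - 1) * W := by
  induction k generalizing S with
  | zero =>
    obtain ⟨J, _, rfl⟩ := hS
    simp
  | succ k ih =>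
    obtain ⟨J, hJ, rfl⟩ := hS
    set S₁ : Set ℝ := ⋃ i : Fin k, J i.castSucc with hS₁
    set T := J (Fin.last k) with hT
    have hU : (⋃ i, J i) = S₁ ∪ T := by
      ext t
      simp only [Set.mem_iUnion, Set.mem_union, hS₁, hT, Fin.exists_fin_succ']
    have b1 := ih (S := S₁) ⟨fun i => J i.castSucc, fun i => hJ _, rfl⟩
    -- Intersecting with one more interval keeps a union of `k` intervals, so the induction
    -- hypothesis applies twice: the constant goes from c to 2c + 1, which gives 2^k - 1.
    have b2 : ‖∑ p ∈ Ioc A B with ((p : ℕ) : ℝ) ∈ S₁ ∩ T, g p‖ ≤ (2 ^ k - 1) * W := by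
      convert! ih (S := S₁ ∩ T) ⟨fun i => J i.castSucc ∩ T, fun i => (hJ _).inter (hJ _), by
        rw [hS₁, Set.iUnion_inter]⟩
    have b3 : ‖∑ p ∈ Ioc A B with ((p : ℕ) : ℝ) ∈ T, g p‖ ≤ W := by
      obtain ⟨a, b, ha, hb, hab⟩ := filter_ordConnected_eq (hJ (Fin.last k)) A B
      rw [hab]
      exact hW a b ha hb
    have e1 : ∑ p ∈ Ioc A B with ((p : ℕ) : ℝ) ∈ ⋃ i, J i, g p
        = ∑ p ∈ Ioc A B with ((p : ℕ) : ℝ) ∈ S₁, g p + ∑ p ∈ Ioc A B with ((p : ℕ) : ℝ) ∈ T, g p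
          - ∑ p ∈ Ioc A B with ((p : ℕ) : ℝ) ∈ S₁ ∩ T, g p := by
      simp only [sum_filter]
      rw [← sum_add_distrib, ← sum_sub_distrib]
      refine sum_congr rfl fun p _ => ?_
      rw [hU]
      by_cases c1 : (p : ℝ) ∈ S₁ <;> by_cases c2 : (p : ℝ) ∈ T <;> simp [c1, c2]
    rw [e1]
    refine (norm_sub_le _ _).trans ((add_le_add_left (norm_add_le _ _) _).trans ?_)
    rw [pow_succ]
    linarith

/-! ### A Vaughan-type identity for sums over primes. -/

/-- `∑ e(β p)` over the primes of `(a, b]`. -/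
noncomputable def primeSum (β : ℝ) (a b : ℕ) : ℂ := ∑ p ∈ Ioc a b with p.Prime, e (β * p)

lemma filter_mul_mem_Ioc {l : ℕ} (hl : 0 < l) (a b c : ℕ) :
    {p ∈ Ioc c (b / l) | a < l * p} = Ioc (max c (a / l)) (b / l) := by
  ext p
  simp only [mem_filter, mem_Ioc, max_lt_iff]
  rw [Nat.div_lt_iff_lt_mul hl, mul_comm p l]
  tauto

lemma filter_primeFactorsLE (m c b : ℕ) :
    {p ∈ Ioc c b | p.Prime ∧ PrimeFactorsLE m p}
      = {p ∈ Ioc (max c (largestPrime m - 1)) b | p.Prime} := by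
  ext p
  simp only [mem_filter, mem_Ioc, max_lt_iff, primeFactorsLE_iff]
  constructor
  · rintro ⟨⟨h1, h2⟩, h3, h4⟩
    have := h3.pos
    exact ⟨⟨⟨h1, by omega⟩, h2⟩, h3⟩
  · rintro ⟨⟨⟨h1, h2⟩, h3⟩, h4⟩
    exact ⟨⟨h1, h3⟩, h4, by omega⟩

section PrimeIdentity

variable (β : ℝ) (a b y z : ℕ)

/-- The contribution of the integers `l p ∈ (a, b]` with `p` a large prime. -/
noncomputable def largePrimeSum (l : ℕ) : ℂ :=
  ∑ p ∈ Ioc (max y z) (b / l) with p.Prime, if a < l * p then e (β * l * p) else 0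

lemma norm_sum_small_prime_le {d m : ℕ} (u : ℕ → ℂ) (hu : ∀ p, ‖u p‖ ≤ 1) :
    ‖∑ p ∈ Ioc y (b / d / m) with p.Prime ∧ PrimeFactorsLE m p ∧ p ≤ z, u p‖ ≤ z := by
  refine (norm_sum_le _ _).trans ((sum_le_sum fun p _ => hu p).trans ?_)
  rw [sum_const, nsmul_eq_mul, mul_one]
  have : #{p ∈ Ioc y (b / d / m) | p.Prime ∧ PrimeFactorsLE m p ∧ p ≤ z} ≤ #(Ioc 0 z) := by
    apply card_le_card
    intro p
    simp only [mem_filter, mem_Ioc]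
    omega
  rw [Nat.card_Ioc] at this
  exact_mod_cast this

/-- Decomposition of a linear exponential sum by the largest prime factor. -/
lemma norm_linear_sub_largePrime_le (hy : 0 < y) {d : ℕ} (hd : 0 < d) {W : ℕ → ℝ}
    (hW : ∀ l s t, t ≤ b / l → ‖primeSum (β * l) s t‖ ≤ W l) (hW0 : ∀ l, 0 ≤ W l) :
    ‖∑ n ∈ Ioc (a / d) (b / d), e (β * d * n)
        - ∑ m ∈ Ioc 0 (z / d), largePrimeSum β a b y z (d * m)‖
      ≤ #(Nat.smoothNumbersUpTo (b / d) (y + 1)) + (z : ℝ) ^ 2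
        + ∑ m ∈ Ioc 0 (b / y / d) with z < d * m, W (d * m) := by
  set f : ℕ → ℂ := fun n => if a < d * n then e (β * d * n) else 0 with hf
  have hf1 : ∀ n, ‖f n‖ ≤ 1 := fun n => by
    simp only [hf]; split_ifs <;> simp
  have h0 : ∑ n ∈ Ioc (a / d) (b / d), e (β * d * n) = ∑ n ∈ Ioc 0 (b / d), f n := by
    simp only [hf]
    rw [← sum_filter, filter_mul_mem_Ioc hd]
    simp
  set g : ℕ → ℂ := fun m => ∑ p ∈ Ioc y (b / d / m) with p.Prime ∧ PrimeFactorsLE m p, f (m * p)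
    with hg
  have hg0 : ∀ m, b / d < m → g m = 0 := fun m hm => by
    simp only [hg]; rw [Nat.div_eq_of_lt hm]; simp
  have hsplit : ∑ m ∈ Ioc 0 (b / d), g m
      = ∑ m ∈ Ioc 0 (z / d), g m + ∑ m ∈ Ioc 0 (b / d) with z < d * m, g m := by
    rw [← sum_filter_add_sum_filter_not (Ioc 0 (b / d)) (fun m => z < d * m), add_comm]
    congr 1
    apply sum_subset_zero_on_sdiff
    · intro m
      simp only [mem_filter, mem_Ioc, not_lt, Nat.le_div_iff_mul_le hd, mul_comm m d]
      omega
    · intro m hm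
      apply hg0
      simp only [mem_sdiff, mem_filter, mem_Ioc, not_lt] at hm
      by_contra hlt
      rw [Nat.le_div_iff_mul_le hd, mul_comm m d] at hm
      exact hm.2 ⟨⟨hm.1.1, by omega⟩, hm.1.2⟩
    · intros; rfl
  -- Here m ≤ z, so for p > z the condition that p is at least every prime factor of m is automatic.
  -- Only primes p ≤ z, at most z of them, make the two sums differ.
  have hsmall : ∀ m ∈ Ioc 0 (z / d), ‖g m - largePrimeSum β a b y z (d * m)‖ ≤ z := by
    intro m hm
    rw [mem_Ioc] at hm
    have hmz : m ≤ z := hm.2.trans (Nat.div_le_self _ _)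
    have e1 : largePrimeSum β a b y z (d * m)
        = ∑ p ∈ Ioc y (b / d / m) with (p.Prime ∧ PrimeFactorsLE m p) ∧ ¬ p ≤ z, f (m * p) := by
      unfold largePrimeSum
      rw [Nat.div_div_eq_div_mul]
      refine sum_congr ?_ fun p _ => ?_
      · ext p
        simp only [mem_filter, mem_Ioc, max_lt_iff]
        constructor
        · rintro ⟨⟨⟨h1, h2⟩, h3⟩, h4⟩
          exact ⟨⟨h1, h3⟩, ⟨h4, PrimeFactorsLE.of_le (by omega)⟩, by omega⟩
        · rintro ⟨⟨h1, h3⟩, ⟨h4, h5⟩, h6⟩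
          exact ⟨⟨⟨h1, by omega⟩, h3⟩, h4⟩
      · simp only [hf, mul_assoc]
        push_cast
        simp only [mul_assoc]
    have e2 : g m = ∑ p ∈ Ioc y (b / d / m) with (p.Prime ∧ PrimeFactorsLE m p) ∧ p ≤ z, f (m * p)
        + ∑ p ∈ Ioc y (b / d / m) with (p.Prime ∧ PrimeFactorsLE m p) ∧ ¬ p ≤ z, f (m * p) := by
      simp only [hg]
      rw [← sum_filter_add_sum_filter_not _ (fun p => p ≤ z), filter_filter, filter_filter]
    rw [e1, e2, add_sub_cancel_right]
    simp only [and_assoc]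
    exact norm_sum_small_prime_le b y z _ fun p => hf1 _
  have hlarge : ∀ m ∈ {m ∈ Ioc 0 (b / d) | z < d * m}, ‖g m‖ ≤
      if m ∈ Ioc 0 (b / y / d) then W (d * m) else 0 := by
    intro m hm
    simp only [mem_filter, mem_Ioc] at hm
    have hdm : 0 < d * m := Nat.mul_pos hd hm.1.1
    split_ifs with hmy
    -- The conditions y < p, P⁺(m) ≤ p and a < dmp all bound p from below, so together they cut out
    -- one interval. The `- 1` is due to its open left end.
    · have : g m = primeSum (β * (d * m : ℕ))
          (max (max y (largestPrime m - 1)) (a / (d * m))) (b / (d * m)) := by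
        simp only [hg, hf, primeSum]
        rw [filter_primeFactorsLE, Nat.div_div_eq_div_mul, ← filter_mul_mem_Ioc hdm, filter_filter,
          sum_filter, sum_filter]
        refine sum_congr rfl fun p _ => ?_
        push_cast
        simp only [mul_assoc]
        by_cases c1 : p.Prime <;> by_cases c2 : a < d * (m * p) <;> simp [c1, c2]
      rw [this]
      exact hW _ _ _ le_rfl
    · rw [mem_Ioc, not_and, not_le] at hmy
      have h1 := hmy hm.1.1
      have h2 : b / d / m ≤ y := by
        rw [Nat.div_div_eq_div_mul, Nat.div_lt_iff_lt_mul (by positivity)] at h1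
        rw [Nat.div_div_eq_div_mul]
        refine Nat.le_of_lt_succ ?_
        rw [Nat.div_lt_iff_lt_mul hdm]
        nlinarith
      simp only [hg]
      rw [Ioc_eq_empty_of_le h2]
      simp
  rw [h0, sum_eq_smooth_add_rough f (b / d) y, hsplit]
  have hs : ‖∑ n ∈ Nat.smoothNumbersUpTo (b / d) (y + 1), f n‖
      ≤ #(Nat.smoothNumbersUpTo (b / d) (y + 1)) := by
    refine (norm_sum_le _ _).trans ((sum_le_sum fun p _ => hf1 p).trans ?_)
    simp
  have ht : ‖∑ m ∈ Ioc 0 (z / d), g m - ∑ m ∈ Ioc 0 (z / d), largePrimeSum β a b y z (d * m)‖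
      ≤ (z : ℝ) ^ 2 := by
    rw [← sum_sub_distrib]
    refine (norm_sum_le _ _).trans ((sum_le_sum hsmall).trans ?_)
    rw [sum_const, nsmul_eq_mul, Nat.card_Ioc, sq]
    gcongr
    exact_mod_cast (Nat.sub_le _ _).trans (Nat.div_le_self _ _)
  have hl : ‖∑ m ∈ Ioc 0 (b / d) with z < d * m, g m‖
      ≤ ∑ m ∈ Ioc 0 (b / y / d) with z < d * m, W (d * m) := by
    refine (norm_sum_le _ _).trans ((sum_le_sum hlarge).trans ?_)
    rw [← sum_filter]
    apply sum_le_sum_of_subset_of_nonneg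
    · intro m
      simp only [mem_filter]
      tauto
    · intros; exact hW0 _
  have e3 : ∀ s u v w : ℂ, s + (u + v) - w = s + (u - w) + v := fun _ _ _ _ => by ring
  rw [e3]
  refine (norm_add_le _ _).trans (add_le_add ((norm_add_le _ _).trans (add_le_add hs ht)) hl)

/-- The pairs with dm ≤ z are grouped by l = dm, and the divisor sum of μ vanishes unless l = 1. -/
lemma sum_moebius_mul_sum (g : ℕ → ℂ) {z : ℕ} (hz : 0 < z) :
    ∑ d ∈ Ioc 0 z, (ArithmeticFunction.moebius d : ℂ) * ∑ m ∈ Ioc 0 (z / d), g (d * m) = g 1 := by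
  simp only [mul_sum]
  rw [← sum_divisors_eq_sum_sum (fun d m => (ArithmeticFunction.moebius d : ℂ) * g (d * m))]
  have h : ∀ l ∈ Ioc 0 z, ∑ d ∈ l.divisors, (ArithmeticFunction.moebius d : ℂ) * g (d * (l / d))
      = if l = 1 then g 1 else 0 := by
    intro l hl
    have e1 : ∑ d ∈ l.divisors, (ArithmeticFunction.moebius d : ℂ) * g (d * (l / d))
        = (∑ d ∈ l.divisors, (ArithmeticFunction.moebius d : ℂ)) * g l := by
      rw [sum_mul]
      refine sum_congr rfl fun d hd => ?_
      rw [Nat.mul_div_cancel' (Nat.dvd_of_mem_divisors hd)]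
    have e2 : ∑ d ∈ l.divisors, (ArithmeticFunction.moebius d : ℂ) = if l = 1 then 1 else 0 := by
      have := congrArg (fun F => (F l : ℤ)) ArithmeticFunction.moebius_mul_coe_zeta
      simp only [ArithmeticFunction.coe_mul_zeta_apply, ArithmeticFunction.one_apply] at this
      exact_mod_cast congrArg (fun t : ℤ => (t : ℂ)) this
    rw [e1, e2]
    split_ifs with h
    · simp [h]
    · simp
  rw [sum_congr rfl h, sum_ite_eq' (Ioc 0 z) 1]
  simp [Nat.succ_le_iff, hz]

/-- A prime exponential sum reduced to linear and bilinear sums. -/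
lemma norm_primeSum_le {N : ℕ} (hy : 0 < y) (hz : 0 < z) (ha : max y z ≤ a) (hb : b ≤ N) {W : ℕ → ℝ}
    (hW : ∀ l s t, t ≤ N / l → ‖primeSum (β * l) s t‖ ≤ W l) (hW0 : ∀ l, 0 ≤ W l) :
    ‖primeSum β a b‖ ≤ ∑ d ∈ Ioc 0 z, ‖∑ n ∈ Ioc (a / d) (b / d), e (β * d * n)‖
      + ∑ d ∈ Ioc 0 z, (#(Nat.smoothNumbersUpTo (N / d) (y + 1)) : ℝ) + (z : ℝ) ^ 3
      + ∑ d ∈ Ioc 0 z, ∑ m ∈ Ioc 0 (N / y / d) with z < d * m, W (d * m) := by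
  -- Because max y z ≤ a, the lower cutoff in `largePrimeSum` is implied by a < p.
  have hone : primeSum β a b = largePrimeSum β a b y z 1 := by
    unfold primeSum largePrimeSum
    simp only [Nat.div_one, one_mul, Nat.cast_one, mul_one]
    rw [sum_filter, sum_filter]
    have : Ioc a b = {p ∈ Ioc (max y z) b | a < p} := by
      ext p
      simp only [mem_filter, mem_Ioc]
      omega
    rw [this, sum_filter]
    refine sum_congr rfl fun p _ => ?_
    split_ifs <;> rfl
  rw [hone, ← sum_moebius_mul_sum (largePrimeSum β a b y z) hz]
  refine (norm_sum_le _ _).trans ?_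
  have hterm : ∀ d ∈ Ioc 0 z, ‖(ArithmeticFunction.moebius d : ℂ) *
      ∑ m ∈ Ioc 0 (z / d), largePrimeSum β a b y z (d * m)‖
      ≤ ‖∑ n ∈ Ioc (a / d) (b / d), e (β * d * n)‖ + #(Nat.smoothNumbersUpTo (N / d) (y + 1))
        + (z : ℝ) ^ 2 + ∑ m ∈ Ioc 0 (N / y / d) with z < d * m, W (d * m) := by
    intro d hd
    have hd0 : 0 < d := (mem_Ioc.mp hd).1
    have h1 := norm_linear_sub_largePrime_le β a b y z hy hd0
      (fun l s t ht => hW l s t (ht.trans (Nat.div_le_div_right hb))) hW0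
    have hμ : ‖(ArithmeticFunction.moebius d : ℂ)‖ ≤ 1 := by
      have := ArithmeticFunction.abs_moebius_le_one (n := d)
      rw [Complex.norm_intCast]
      exact_mod_cast this
    have h2 : (#(Nat.smoothNumbersUpTo (b / d) (y + 1)) : ℝ)
        ≤ #(Nat.smoothNumbersUpTo (N / d) (y + 1)) := by
      have : Nat.smoothNumbersUpTo (b / d) (y + 1) ⊆ Nat.smoothNumbersUpTo (N / d) (y + 1) := by
        intro n
        simp only [Nat.mem_smoothNumbersUpTo]
        exact fun h => ⟨h.1.trans (Nat.div_le_div_right hb), h.2⟩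
      exact_mod_cast card_le_card this
    have h3 : ∑ m ∈ Ioc 0 (b / y / d) with z < d * m, W (d * m)
        ≤ ∑ m ∈ Ioc 0 (N / y / d) with z < d * m, W (d * m) := by
      apply sum_le_sum_of_subset_of_nonneg
      · apply filter_subset_filter
        apply Ioc_subset_Ioc_right
        exact Nat.div_le_div_right (Nat.div_le_div_right hb)
      · intros; exact hW0 _
    rw [norm_mul]
    refine (mul_le_of_le_one_left (norm_nonneg _) hμ).trans ?_
    have h4 := norm_sub_norm_le (∑ m ∈ Ioc 0 (z / d), largePrimeSum β a b y z (d * m))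
      (∑ n ∈ Ioc (a / d) (b / d), e (β * d * n))
    rw [norm_sub_rev] at h4
    linarith
  refine (sum_le_sum hterm).trans (le_of_eq ?_)
  simp only [sum_add_distrib]
  rw [sum_const, Nat.card_Ioc, nsmul_eq_mul]
  simp only [tsub_zero]
  ring

end PrimeIdentity

/-! ### Reduction of the sum over 𝓑 to prime sums. -/

open Classical in
lemma expSum_eq (I : ℕ → Set ℝ) (x γ : ℝ) :
    expSum I x γ = ∑ n ∈ Ioc 0 ⌊x⌋₊, if n ∈ seqB I then e (γ * n) else 0 := by
  unfold expSum
  rw [sum_filter]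
  refine sum_congr ?_ fun _ _ => rfl
  ext n
  simp only [mem_Icc, mem_Ioc]
  omega

/-- Reduction of the exponential sum to sums over primes in intervals. -/
lemma norm_expSum_le_primeSum {k : ℕ} {I : ℕ → Set ℝ} (hI : ∀ n, IsUnionOfIntervals k (I n))
    (x γ : ℝ) {y : ℕ} (hy : 0 < y) (z : ℕ) {W T : ℕ → ℝ}
    (hW : ∀ l s t, t ≤ ⌊x⌋₊ / l → ‖primeSum (γ * l) s t‖ ≤ W l)
    (hT : ∀ m ∈ Ioc 0 z, ∀ s t, max y z ≤ s → t ≤ ⌊x⌋₊ / m → ‖primeSum (γ * m) s t‖ ≤ T m) :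
    ‖expSum I x γ‖ ≤ #(Nat.smoothNumbersUpTo ⌊x⌋₊ (y + 1)) + (z : ℝ) ^ 2
      + 2 ^ k * (∑ m ∈ Ioc 0 z, T m + ∑ l ∈ Ioc z (⌊x⌋₊ / y), W l) := by
  classical
  set X := ⌊x⌋₊ with hX
  set F : ℕ → ℂ := fun n => if n ∈ seqB I then e (γ * n) else 0 with hF
  have hF1 : ∀ n, ‖F n‖ ≤ 1 := fun n => by
    simp only [hF]; split_ifs <;> simp
  have hW0 : ∀ l, 0 ≤ W l := fun l => (norm_nonneg _).trans (hW l 0 0 (Nat.zero_le _))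
  have hT0 : ∀ m ∈ Ioc 0 z, 0 ≤ T m := fun m hm => by
    have := hT m hm (max y z) 0 le_rfl (Nat.zero_le _)
    exact (norm_nonneg _).trans this
  have hmulF : ∀ {m p : ℕ}, 0 < m → p.Prime → PrimeFactorsLE m p →
      F (m * p) = if m ∈ seqB I then (if (p : ℝ) ∈ I m then e (γ * m * p) else 0) else 0 := by
    intro m p hm hp h
    simp only [hF, mul_mem_seqB_iff hm hp h]
    push_cast
    rw [mul_assoc]
    by_cases c1 : m ∈ seqB I <;> by_cases c2 : (p : ℝ) ∈ I m <;> simp [c1, c2]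
  have hk1 : (1 : ℝ) ≤ 2 ^ k := one_le_pow₀ (by norm_num)
  have hunion : ∀ {m A B : ℕ} {V : ℝ}, 0 ≤ V →
      (∀ s t, A ≤ s → t ≤ B → ‖primeSum (γ * m) s t‖ ≤ V) →
      ‖∑ p ∈ Ioc A B, if (p : ℝ) ∈ I m then (if p.Prime then e (γ * m * p) else 0) else 0‖
        ≤ 2 ^ k * V := by
    intro m A B V hV h
    have := norm_sum_unionOfIntervals_le (fun p => if p.Prime then e (γ * m * p) else 0)
      (A := A) (B := B) (W := V) (fun s t hs ht => by
        have := h s t hs ht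
        unfold primeSum at this
        rwa [sum_filter] at this) k (hI m)
    rw [sum_filter] at this
    exact this.trans (by nlinarith)
  set g : ℕ → ℂ := fun m => ∑ p ∈ Ioc y (X / m) with p.Prime ∧ PrimeFactorsLE m p, F (m * p)
    with hg
  have hg0 : ∀ m, X / m ≤ y → g m = 0 := fun m hm => by
    simp only [hg]; rw [Ioc_eq_empty_of_le hm]; simp
  have hgX : ∀ m, X < m → g m = 0 := fun m hm => hg0 m (by rw [Nat.div_eq_of_lt hm]; exact hy.le)
  have hlarge : ∀ m ∈ Ioc z (X / y), ‖g m‖ ≤ 2 ^ k * W m := by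
    intro m hm
    have hm0 : 0 < m := by
      have := (mem_Ioc.mp hm).1
      omega
    by_cases hB : m ∈ seqB I
    · have : g m = ∑ p ∈ Ioc (max y (largestPrime m - 1)) (X / m),
          if (p : ℝ) ∈ I m then (if p.Prime then e (γ * m * p) else 0) else 0 := by
        have e1 : g m = ∑ p ∈ Ioc y (X / m) with p.Prime ∧ PrimeFactorsLE m p,
            if (p : ℝ) ∈ I m then e (γ * m * p) else 0 := by
          refine sum_congr rfl fun p hp => ?_
          rw [mem_filter] at hp
          rw [hmulF hm0 hp.2.1 hp.2.2, if_pos hB]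
        rw [e1, filter_primeFactorsLE, sum_filter]
        refine sum_congr rfl fun p _ => ?_
        split_ifs <;> rfl
      rw [this]
      exact hunion (hW0 m) fun s t _ ht => hW m s t ht
    · have : g m = 0 := by
        refine sum_eq_zero fun p hp => ?_
        rw [mem_filter] at hp
        rw [hmulF hm0 hp.2.1 hp.2.2, if_neg hB]
      rw [this, norm_zero]
      exact mul_nonneg (by positivity) (hW0 m)
  have hsmall : ∀ m ∈ Ioc 0 z, ‖g m‖ ≤ z + 2 ^ k * T m := by
    intro m hm
    have hTm := hT0 m hm
    have hm' := mem_Ioc.mp hm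
    have e2 : g m = ∑ p ∈ Ioc y (X / m) with (p.Prime ∧ PrimeFactorsLE m p) ∧ p ≤ z, F (m * p)
        + ∑ p ∈ Ioc y (X / m) with (p.Prime ∧ PrimeFactorsLE m p) ∧ ¬ p ≤ z, F (m * p) := by
      simp only [hg]
      rw [← sum_filter_add_sum_filter_not _ (fun p => p ≤ z), filter_filter, filter_filter]
    have b1 : ‖∑ p ∈ Ioc y (X / m) with (p.Prime ∧ PrimeFactorsLE m p) ∧ p ≤ z, F (m * p)‖
        ≤ z := by
      have := norm_sum_small_prime_le X y z (d := 1) (m := m) (fun p => F (m * p))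
        (fun p => hF1 _)
      simp only [Nat.div_one, ← and_assoc] at this
      exact this
    have b2 : ‖∑ p ∈ Ioc y (X / m) with (p.Prime ∧ PrimeFactorsLE m p) ∧ ¬ p ≤ z, F (m * p)‖
        ≤ 2 ^ k * T m := by
      by_cases hB : m ∈ seqB I
      · have : ∑ p ∈ Ioc y (X / m) with (p.Prime ∧ PrimeFactorsLE m p) ∧ ¬ p ≤ z, F (m * p)
            = ∑ p ∈ Ioc (max y z) (X / m),
              if (p : ℝ) ∈ I m then (if p.Prime then e (γ * m * p) else 0) else 0 := by
          have e1 : ∑ p ∈ Ioc y (X / m) with (p.Prime ∧ PrimeFactorsLE m p) ∧ ¬ p ≤ z, F (m * p)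
              = ∑ p ∈ Ioc (max y z) (X / m) with p.Prime,
                if (p : ℝ) ∈ I m then e (γ * m * p) else 0 := by
            refine sum_congr ?_ fun p hp => ?_
            · ext p
              simp only [mem_filter, mem_Ioc, max_lt_iff]
              constructor
              · rintro ⟨⟨h1, h2⟩, ⟨h3, h4⟩, h5⟩
                exact ⟨⟨⟨h1, by omega⟩, h2⟩, h3⟩
              · rintro ⟨⟨⟨h1, h2⟩, h3⟩, h4⟩
                exact ⟨⟨h1, h3⟩, ⟨h4, PrimeFactorsLE.of_le (by omega)⟩, by omega⟩
            · rw [mem_filter, mem_Ioc, max_lt_iff] at hp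
              rw [hmulF hm'.1 hp.2 (PrimeFactorsLE.of_le (by omega)), if_pos hB]
          rw [e1, sum_filter]
          refine sum_congr rfl fun p _ => ?_
          split_ifs <;> rfl
        rw [this]
        exact hunion hTm fun s t hs ht => hT m hm s t hs ht
      · rw [sum_eq_zero, norm_zero]
        · positivity
        · intro p hp
          rw [mem_filter] at hp
          rw [hmulF hm'.1 hp.2.1.1 hp.2.1.2, if_neg hB]
    rw [e2]
    exact (norm_add_le _ _).trans (add_le_add b1 b2)
  have hsum : ∑ m ∈ Ioc 0 X, g m = ∑ m ∈ Ioc 0 z, g m + ∑ m ∈ Ioc z (X / y), g m := by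
    -- `z` may exceed `X` or `X / y`, so the sums are extended to a common upper end; the added
    -- terms vanish.
    set U := max X (max z (X / y)) with hU
    have e1 : ∑ m ∈ Ioc 0 X, g m = ∑ m ∈ Ioc 0 U, g m := by
      apply sum_subset (Ioc_subset_Ioc_right (le_max_left _ _))
      intro m hm hm'
      simp only [mem_Ioc] at hm hm'
      exact hgX m (by omega)
    have e2 : ∑ m ∈ Ioc z (X / y), g m = ∑ m ∈ Ioc z U, g m := by
      apply sum_subset (Ioc_subset_Ioc_right (by simp [hU]))
      intro m hm hm'
      simp only [mem_Ioc] at hm hm'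
      apply hg0
      have h1 : X / y < m := by omega
      rw [Nat.div_lt_iff_lt_mul hy] at h1
      have : X / m ≤ y := by
        refine Nat.le_of_lt_succ ?_
        rw [Nat.div_lt_iff_lt_mul (by omega)]
        nlinarith
      exact this
    rw [e1, e2, sum_Ioc_consecutive _ (Nat.zero_le _) (by simp [hU])]
  rw [expSum_eq, sum_eq_smooth_add_rough _ X y]
  change ‖∑ n ∈ Nat.smoothNumbersUpTo X (y + 1), F n + ∑ m ∈ Ioc 0 X, g m‖ ≤ _
  rw [hsum]
  have hs : ‖∑ n ∈ Nat.smoothNumbersUpTo X (y + 1), F n‖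
      ≤ #(Nat.smoothNumbersUpTo X (y + 1)) := by
    refine (norm_sum_le _ _).trans ((sum_le_sum fun p _ => hF1 p).trans ?_)
    simp
  have h1 : ‖∑ m ∈ Ioc 0 z, g m‖ ≤ (z : ℝ) ^ 2 + 2 ^ k * ∑ m ∈ Ioc 0 z, T m := by
    refine (norm_sum_le _ _).trans ((sum_le_sum hsmall).trans (le_of_eq ?_))
    rw [sum_add_distrib, sum_const, Nat.card_Ioc, nsmul_eq_mul, mul_sum, tsub_zero, sq]
  have h2 : ‖∑ m ∈ Ioc z (X / y), g m‖ ≤ 2 ^ k * ∑ m ∈ Ioc z (X / y), W m := by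
    refine (norm_sum_le _ _).trans ((sum_le_sum hlarge).trans (le_of_eq ?_))
    rw [mul_sum]
  refine (norm_add_le _ _).trans ?_
  have h3 := norm_add_le (∑ m ∈ Ioc 0 z, g m) (∑ m ∈ Ioc z (X / y), g m)
  linarith

/-- The exponential sum is controlled by linear sums, smooth numbers and a bilinear sum weighted by
the ternary divisor function. -/
lemma norm_expSum_le {k : ℕ} {I : ℕ → Set ℝ} (hI : ∀ n, IsUnionOfIntervals k (I n))
    (x γ : ℝ) {y z : ℕ} (hy : 0 < y) (hz : 0 < z) {W : ℕ → ℝ} {G : ℝ}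
    (hW : ∀ l s t, t ≤ ⌊x⌋₊ / l → ‖primeSum (γ * l) s t‖ ≤ W l)
    (hG : ∀ j ∈ Ioc 0 (z * z), ∀ s t : ℕ, ‖∑ n ∈ Ioc s t, e (γ * j * n)‖ ≤ G) :
    ‖expSum I x γ‖ ≤ #(Nat.smoothNumbersUpTo ⌊x⌋₊ (y + 1)) + (z : ℝ) ^ 2
      + 2 ^ k * ((z : ℝ) ^ 2 * G
        + ∑ m ∈ Ioc 0 z, ∑ d ∈ Ioc 0 z, (#(Nat.smoothNumbersUpTo (⌊x⌋₊ / (m * d)) (y + 1)) : ℝ)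
        + (z : ℝ) ^ 4 + 2 * ∑ l ∈ Ioc z (⌊x⌋₊ / y), ternaryDivisor l * W l) := by
  set X := ⌊x⌋₊ with hX
  have hW0 : ∀ l, 0 ≤ W l := fun l => (norm_nonneg _).trans (hW l 0 0 (Nat.zero_le _))
  set T : ℕ → ℝ := fun m => z * G
      + ∑ d ∈ Ioc 0 z, (#(Nat.smoothNumbersUpTo (X / (m * d)) (y + 1)) : ℝ) + (z : ℝ) ^ 3
      + ∑ d ∈ Ioc 0 z, ∑ b ∈ Ioc 0 (X / y / (m * d)) with z < d * b, W (m * d * b) with hTdef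
  have hT : ∀ m ∈ Ioc 0 z, ∀ s t, max y z ≤ s → t ≤ X / m → ‖primeSum (γ * m) s t‖ ≤ T m := by
    intro m hm s t hs ht
    have hm' := mem_Ioc.mp hm
    have h := norm_primeSum_le (γ * m) s t y z hy hz hs ht (W := fun l => W (m * l))
      (fun l s t ht => by
        have := hW (m * l) s t (by rwa [← Nat.div_div_eq_div_mul])
        push_cast at this
        rwa [← mul_assoc] at this) (fun l => hW0 _)
    refine h.trans ?_
    simp only [hTdef]
    gcongr ?_ + ?_ + _ + ?_
    · have : ∀ d ∈ Ioc 0 z, ‖∑ n ∈ Ioc (s / d) (t / d), e (γ * m * d * n)‖ ≤ G := by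
        intro d hd
        have hd' := mem_Ioc.mp hd
        have := hG (m * d) (mem_Ioc.mpr ⟨Nat.mul_pos hm'.1 hd'.1, Nat.mul_le_mul hm'.2 hd'.2⟩)
          (s / d) (t / d)
        push_cast at this
        rwa [← mul_assoc] at this
      refine (sum_le_sum this).trans (le_of_eq ?_)
      simp
    · refine sum_le_sum fun d _ => ?_
      rw [Nat.div_div_eq_div_mul]
    · refine sum_le_sum fun d _ => ?_
      have : X / m / y / d = X / y / (m * d) := by
        rw [Nat.div_div_eq_div_mul X m y, mul_comm m y, ← Nat.div_div_eq_div_mul,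
          Nat.div_div_eq_div_mul (X / y)]
      rw [this]
      simp only [mul_assoc, le_refl]
  have hmain := norm_expSum_le_primeSum hI x γ hy z hW hT
  refine hmain.trans ?_
  have hTsum : ∑ m ∈ Ioc 0 z, T m ≤ (z : ℝ) ^ 2 * G
      + ∑ m ∈ Ioc 0 z, ∑ d ∈ Ioc 0 z, (#(Nat.smoothNumbersUpTo (X / (m * d)) (y + 1)) : ℝ)
      + (z : ℝ) ^ 4 + ∑ l ∈ Ioc z (X / y), ternaryDivisor l * W l := by
    have h3 := sum_triple_le hW0 z (X / y)
    simp only [hTdef, sum_add_distrib, sum_const, Nat.card_Ioc, nsmul_eq_mul, tsub_zero]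
    have e1 : (z : ℝ) * (z * G) = (z : ℝ) ^ 2 * G := by ring
    have e2 : (z : ℝ) * (z : ℝ) ^ 3 = (z : ℝ) ^ 4 := by ring
    rw [e1, e2]
    linarith
  have hWsum : ∑ l ∈ Ioc z (X / y), W l ≤ ∑ l ∈ Ioc z (X / y), ternaryDivisor l * W l := by
    refine sum_le_sum fun l hl => ?_
    have := mem_Ioc.mp hl
    exact le_mul_of_one_le_left (hW0 l) (one_le_ternaryDivisor (by omega))
  have hk : (0 : ℝ) ≤ 2 ^ k := by positivity
  have := mul_le_mul_of_nonneg_left (add_le_add hTsum hWsum) hk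
  linarith

/-! ### Mean squares of maximal prime sums, and linear sums. -/

/-- The maximum of `|∑ e(γ l p)|` over intervals of primes up to `X / l`. -/
noncomputable def maxPrimeSum (X : ℕ) (γ : ℝ) (l : ℕ) : ℝ :=
  ⨆ i : Fin (X / l + 1) × Fin (X / l + 1), ‖primeSum (γ * l) i.1 i.2‖

lemma exists_maxPrimeSum_eq (X : ℕ) (γ : ℝ) (l : ℕ) :
    ∃ s t : ℕ, t ≤ X / l ∧ maxPrimeSum X γ l = ‖primeSum (γ * l) s t‖ := by
  obtain ⟨i, hi⟩ := exists_eq_ciSup_of_finite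
    (f := fun i : Fin (X / l + 1) × Fin (X / l + 1) => ‖primeSum (γ * l) i.1 i.2‖)
  exact ⟨i.1, i.2, by have := i.2.2; omega, hi.symm⟩

lemma maxPrimeSum_nonneg (X : ℕ) (γ : ℝ) (l : ℕ) : 0 ≤ maxPrimeSum X γ l := by
  obtain ⟨s, t, _, h⟩ := exists_maxPrimeSum_eq X γ l
  rw [h]; exact norm_nonneg _

lemma norm_primeSum_le_max (X : ℕ) (γ : ℝ) (l s t : ℕ) (ht : t ≤ X / l) :
    ‖primeSum (γ * l) s t‖ ≤ maxPrimeSum X γ l := by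
  rcases le_or_gt s t with h | h
  · exact le_ciSup (f := fun i : Fin (X / l + 1) × Fin (X / l + 1) =>
      ‖primeSum (γ * l) i.1 i.2‖) (Set.finite_range _).bddAbove
      (⟨s, by omega⟩, ⟨t, by omega⟩)
  · unfold primeSum
    rw [Ioc_eq_empty_of_le h.le]
    simpa using maxPrimeSum_nonneg X γ l

section Bilinear

variable {α : ℝ} {a q h : ℕ}

/-- The extremal intervals are chosen for each `l`, and the maximal bilinear estimate is applied
with the indicator of the primes as coefficients. The weight `l`, of size `M`, combines with the
inner length 2^K into 2^K M ≤ 2X. -/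
lemma sum_mul_maxPrimeSum_sq_dyadic_le (hq : 0 < q) (haq : Nat.Coprime a q)
    (hα : |α - (a : ℝ) / q| ≤ 1 / (q : ℝ) ^ 2) (hh : 0 < h) {X M : ℕ} (hM : 0 < M)
    (hMX : M ≤ X) :
    ∑ l ∈ Ioc M (2 * M), (l : ℝ) * maxPrimeSum X (α * h) l ^ 2
      ≤ 16 * ((Nat.log 2 X + 1 : ℕ) : ℝ) ^ 2 * X * (9 * M + 16 * h * X / q
        + 4 * h * X * (1 + Real.log q) / M + 2 * q * (1 + Real.log q)) := by
  have hM' : (0 : ℝ) < M := by exact_mod_cast hM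
  have hq' : (0 : ℝ) < q := by exact_mod_cast hq
  set lam := 1 + Real.log q with hlam
  have hlam0 : 0 ≤ lam := by
    have := Real.log_natCast_nonneg q
    positivity
  set K := Nat.log 2 (X / M) + 1 with hK
  have hXM : 0 < X / M := Nat.div_pos hMX hM
  have hKlt : X / M < 2 ^ K := Nat.lt_pow_succ_log_self (by norm_num) _
  have hKle : (2 : ℝ) ^ K * M ≤ 2 * X := by
    have h1 : 2 ^ Nat.log 2 (X / M) ≤ X / M := Nat.pow_log_le_self 2 hXM.ne'
    have h2 : 2 ^ K * M ≤ 2 * X := by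
      have := Nat.div_mul_le_self X M
      rw [hK, pow_succ]
      nlinarith
    exact_mod_cast h2
  have hKK : (K : ℝ) ≤ ((Nat.log 2 X + 1 : ℕ) : ℝ) := by
    have : Nat.log 2 (X / M) ≤ Nat.log 2 X := Nat.log_mono_right (Nat.div_le_self _ _)
    exact_mod_cast (by omega)
  choose A B hB hAB using exists_maxPrimeSum_eq X (α * h)
  have hsq := sum_norm_interval_sq_le (α * h) (c := fun p => if p.Prime then 1 else 0)
    (fun p => by split_ifs <;> simp) (K := K) hM A B (fun l hl => by
      have := mem_Ioc.mp hl
      exact ((hB l).trans (Nat.div_le_div_left this.1.le hM)).trans_lt hKlt)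
  have hsum := sum_distKernel_mul_le (M := (M : ℝ)) hM' hq haq hα hh (2 ^ K)
  set u : ℝ := 2 ^ K with hu
  have hu0 : 0 < u := by positivity
  have e1 : ∑ l ∈ Ioc M (2 * M), (l : ℝ) * maxPrimeSum X (α * h) l ^ 2
      ≤ 2 * M * ∑ l ∈ Ioc M (2 * M), ‖∑ n ∈ Ioc (A l) (B l),
        (if n.Prime then (1 : ℂ) else 0) * e (α * h * l * n)‖ ^ 2 := by
    rw [mul_sum]
    refine sum_le_sum fun l hl => ?_
    have hl2 : (l : ℝ) ≤ 2 * M := by exact_mod_cast (mem_Ioc.mp hl).2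
    have : primeSum (α * h * l) (A l) (B l)
        = ∑ n ∈ Ioc (A l) (B l), (if n.Prime then (1 : ℂ) else 0) * e (α * h * l * n) := by
      unfold primeSum
      rw [sum_filter]
      refine sum_congr rfl fun p _ => ?_
      split_ifs <;> simp
    rw [hAB, this]
    gcongr
  have e2 : (M : ℝ) + 2 * ∑ d ∈ Ioc (0 : ℕ) (2 ^ K), distKernel M (α * h * d)
      ≤ M + 2 * ((h * u / q + 1) * (4 * M + q * lam)) := by
    have : (((h * 2 ^ K : ℕ) : ℝ) / q + 1) = h * u / q + 1 := by
      rw [hu]; push_cast; rfl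
    rw [this] at hsum
    gcongr
  calc _ ≤ 2 * M * (4 * K ^ 2 * u * (M + 2 * ((h * u / q + 1) * (4 * M + q * lam)))) := by
        refine e1.trans ?_
        gcongr
        refine hsq.trans ?_
        gcongr
    _ = 8 * K ^ 2 * (u * M) * (9 * M + 8 * h * (u * M) / q + 2 * h * (u * M) * lam / M
          + 2 * q * lam) := by
        field_simp
        ring
    _ ≤ 8 * ((Nat.log 2 X + 1 : ℕ) : ℝ) ^ 2 * (2 * X) * (9 * M + 8 * h * (2 * X) / q
          + 2 * h * (2 * X) * lam / M + 2 * q * lam) := by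
        gcongr
    _ = _ := by ring

lemma sum_dyadic_eq (f : ℕ → ℝ) (z J : ℕ) :
    ∑ l ∈ Ioc z (z * 2 ^ J), f l = ∑ j ∈ range J, ∑ l ∈ Ioc (z * 2 ^ j) (2 * (z * 2 ^ j)), f l := by
  induction J with
  | zero => simp
  | succ J ih =>
    rw [sum_range_succ, ← ih, sum_Ioc_consecutive]
    · congr 2
      ring
    · exact Nat.le_mul_of_pos_right _ (by positivity)
    · omega

/-- Over the dyadic blocks the term in 1/M sums geometrically, dominated by M = z; the other terms
are multiplied by the number of blocks, which costs one logarithm. -/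
lemma sum_mul_maxPrimeSum_sq_le (hq : 0 < q) (haq : Nat.Coprime a q)
    (hα : |α - (a : ℝ) / q| ≤ 1 / (q : ℝ) ^ 2) (hh : 0 < h) {X z Q : ℕ} (hz : 0 < z)
    (hQX : Q ≤ X) :
    ∑ l ∈ Ioc z Q, (l : ℝ) * maxPrimeSum X (α * h) l ^ 2
      ≤ 16 * ((Nat.log 2 X + 1 : ℕ) : ℝ) ^ 2 * X * (((Nat.log 2 X + 1 : ℕ) : ℝ)
          * (9 * Q + 16 * h * X / q + 2 * q * (1 + Real.log q))
        + 8 * h * X * (1 + Real.log q) / z) := by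
  have hz' : (0 : ℝ) < z := by exact_mod_cast hz
  have hlog : 0 ≤ Real.log q := Real.log_natCast_nonneg q
  rcases le_or_gt Q z with hQz | hQz
  · rw [Ioc_eq_empty_of_le hQz, sum_empty]
    positivity
  set K₀ := Nat.log 2 X + 1 with hK₀
  set J := Nat.log 2 (Q / z) + 1 with hJ
  have hQz0 : 0 < Q / z := Nat.div_pos hQz.le hz
  have hJK : (J : ℝ) ≤ K₀ := by
    have : Nat.log 2 (Q / z) ≤ Nat.log 2 X :=
      Nat.log_mono_right ((Nat.div_le_self _ _).trans hQX)
    exact_mod_cast (by omega)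
  have hQJ : Q ≤ z * 2 ^ J := by
    have : Q / z < 2 ^ J := Nat.lt_pow_succ_log_self (by norm_num) _
    rw [Nat.div_lt_iff_lt_mul hz, mul_comm] at this
    exact this.le
  have hjQ : ∀ j ∈ range J, z * 2 ^ j ≤ Q := by
    intro j hj
    have h1 : 2 ^ Nat.log 2 (Q / z) ≤ Q / z := Nat.pow_log_le_self 2 hQz0.ne'
    have h2 : 2 ^ j ≤ 2 ^ Nat.log 2 (Q / z) :=
      Nat.pow_le_pow_right (by norm_num) (by have := mem_range.mp hj; omega)
    calc z * 2 ^ j ≤ z * (Q / z) := Nat.mul_le_mul_left _ (h2.trans h1)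
      _ ≤ Q := Nat.mul_div_le _ _
  have hgeom : ∑ j ∈ range J, (1 : ℝ) / 2 ^ j ≤ 2 := by
    have := sum_geometric_two_le J
    simpa only [one_div, inv_pow] using this
  calc _ ≤ ∑ l ∈ Ioc z (z * 2 ^ J), (l : ℝ) * maxPrimeSum X (α * h) l ^ 2 := by
        apply sum_le_sum_of_subset_of_nonneg (Ioc_subset_Ioc_right hQJ)
        intros; positivity
    _ = ∑ j ∈ range J, ∑ l ∈ Ioc (z * 2 ^ j) (2 * (z * 2 ^ j)),
          (l : ℝ) * maxPrimeSum X (α * h) l ^ 2 := sum_dyadic_eq _ _ _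
    _ ≤ ∑ j ∈ range J, 16 * (K₀ : ℝ) ^ 2 * X * ((9 * Q + 16 * h * X / q
          + 2 * q * (1 + Real.log q)) + 4 * h * X * (1 + Real.log q) / z * (1 / 2 ^ j)) := by
        refine sum_le_sum fun j hj => ?_
        refine (sum_mul_maxPrimeSum_sq_dyadic_le hq haq hα hh (by positivity)
          ((hjQ j hj).trans hQX)).trans ?_
        have h1 : ((z * 2 ^ j : ℕ) : ℝ) ≤ Q := by exact_mod_cast hjQ j hj
        have h2 : 4 * h * X * (1 + Real.log q) / ((z * 2 ^ j : ℕ) : ℝ)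
            = 4 * h * X * (1 + Real.log q) / z * (1 / 2 ^ j) := by
          push_cast; field_simp
        rw [h2]
        gcongr _ * ?_
        linarith
    _ = 16 * (K₀ : ℝ) ^ 2 * X * (J * (9 * Q + 16 * h * X / q
          + 2 * q * (1 + Real.log q)) + 4 * h * X * (1 + Real.log q) / z
            * ∑ j ∈ range J, 1 / 2 ^ j) := by
        rw [← mul_sum, sum_add_distrib, ← mul_sum, sum_const, card_range, nsmul_eq_mul]
    _ ≤ 16 * (K₀ : ℝ) ^ 2 * X * (K₀ * (9 * Q + 16 * h * X / q
          + 2 * q * (1 + Real.log q)) + 4 * h * X * (1 + Real.log q) / z * 2) := by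
        gcongr
    _ = _ := by ring

/-- The bilinear sum weighted by the ternary divisor function. -/
lemma sum_ternaryDivisor_mul_maxPrimeSum_sq_le (hq : 0 < q) (haq : Nat.Coprime a q)
    (hα : |α - (a : ℝ) / q| ≤ 1 / (q : ℝ) ^ 2) (hh : 0 < h) {X z Q : ℕ} (hz : 0 < z)
    (hQX : Q ≤ X) :
    (∑ l ∈ Ioc z Q, ternaryDivisor l * maxPrimeSum X (α * h) l) ^ 2
      ≤ (1 + Real.log X) ^ 9 * (16 * ((Nat.log 2 X + 1 : ℕ) : ℝ) ^ 2 * X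
        * (((Nat.log 2 X + 1 : ℕ) : ℝ) * (9 * Q + 16 * h * X / q + 2 * q * (1 + Real.log q))
        + 8 * h * X * (1 + Real.log q) / z)) := by
  -- The weight √l is placed so that the divisor side becomes ∑ τ₃(l)²/l, a power of the logarithm.
  have hcs := sum_mul_sq_le_sq_mul_sq (Ioc z Q) (fun l => ternaryDivisor l / √(l : ℝ))
    (fun l => √(l : ℝ) * maxPrimeSum X (α * h) l)
  have e1 : ∑ l ∈ Ioc z Q, ternaryDivisor l / √(l : ℝ) * (√(l : ℝ) * maxPrimeSum X (α * h) l)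
      = ∑ l ∈ Ioc z Q, ternaryDivisor l * maxPrimeSum X (α * h) l := by
    refine sum_congr rfl fun l hl => ?_
    have hl0 : (0 : ℝ) < l := by
      have := mem_Ioc.mp hl
      exact_mod_cast (by omega : 0 < l)
    have : 0 < √(l : ℝ) := Real.sqrt_pos.mpr hl0
    field_simp
  have e2 : ∑ l ∈ Ioc z Q, (ternaryDivisor l / √(l : ℝ)) ^ 2 ≤ (1 + Real.log X) ^ 9 := by
    refine le_trans ?_ (sum_ternaryDivisor_sq_div_le X)
    simp only [div_pow, Real.sq_sqrt (Nat.cast_nonneg _)]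
    apply sum_le_sum_of_subset_of_nonneg (Ioc_subset_Ioc (Nat.zero_le _) hQX)
    intros; positivity
  have e3 : ∑ l ∈ Ioc z Q, (√(l : ℝ) * maxPrimeSum X (α * h) l) ^ 2
      = ∑ l ∈ Ioc z Q, (l : ℝ) * maxPrimeSum X (α * h) l ^ 2 := by
    simp only [mul_pow, Real.sq_sqrt (Nat.cast_nonneg _)]
  rw [e1, e3] at hcs
  refine hcs.trans ?_
  have hlog : 0 ≤ Real.log X := Real.log_natCast_nonneg X
  gcongr
  exact sum_mul_maxPrimeSum_sq_le hq haq hα hh hz hQX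

/-- While hj ≤ q/2 the frequency αhj stays 1/(2q) away from the integers, so the geometric sum is at
most q whatever its length. -/
lemma norm_linear_sum_le (hq : 0 < q) (haq : Nat.Coprime a q)
    (hα : |α - (a : ℝ) / q| ≤ 1 / (q : ℝ) ^ 2) (hh : 0 < h) {j : ℕ} (hj : 0 < j)
    (hjq : 2 * (h * j) ≤ q) (s t : ℕ) :
    ‖∑ n ∈ Ioc s t, e (α * h * j * n)‖ ≤ q := by
  have hq' : (0 : ℝ) < q := by exact_mod_cast hq
  have h1 := norm_mul_ge hq haq hα (Nat.mul_pos hh hj) hjq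
  have h2 := norm_sum_e_mul_dist_le (α * h * j) s t
  push_cast at h1
  rw [← mul_assoc] at h1
  set S := ‖∑ n ∈ Ioc s t, e (α * h * j * n)‖
  have h3 : S * (1 / q) ≤ 1 := by
    calc S * (1 / q) = S * (2 * (1 / (2 * q))) := by field_simp
      _ ≤ S * (2 * ‖((α * h * j : ℝ) : UnitAddCircle)‖) := by gcongr
      _ ≤ 1 := h2
  rwa [mul_one_div, div_le_one hq'] at h3

end Bilinear

/-! ### Smooth numbers at the required level. -/

section Smooth

/-- Smooth numbers, averaged over two multipliers. -/
lemma sum_card_smooth_le {δ : ℝ} (hδ0 : 0 ≤ δ) (hδ : δ ≤ 1 / 2) {x : ℝ} (hx : 0 ≤ x) {y J : ℕ}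
    (hy : y ≤ 2 ^ (J + 1)) (z : ℕ) :
    ∑ m ∈ Ioc 0 z, ∑ d ∈ Ioc 0 z, (#(Nat.smoothNumbersUpTo (⌊x⌋₊ / (m * d)) (y + 1)) : ℝ)
      ≤ x ^ (1 - δ) * Real.exp (4 * ((y : ℝ) ^ δ * (5 + 4 * Real.log J)))
        * ((z : ℝ) ^ δ) ^ 2 * (1 + Real.log z) ^ 2 := by
  set E := Real.exp (4 * ((y : ℝ) ^ δ * (5 + 4 * Real.log J))) with hE
  have hterm : ∀ m ∈ Ioc 0 z, ∀ d ∈ Ioc 0 z,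
      (#(Nat.smoothNumbersUpTo (⌊x⌋₊ / (m * d)) (y + 1)) : ℝ)
        ≤ x ^ (1 - δ) * E * ((z : ℝ) ^ δ) ^ 2 * (1 / m * (1 / d)) := by
    intro m hm d hd
    rw [mem_Ioc] at hm hd
    have hm0 : (0 : ℝ) < m := by exact_mod_cast hm.1
    have hd0 : (0 : ℝ) < d := by exact_mod_cast hd.1
    have hmz : (m : ℝ) ≤ z := by exact_mod_cast hm.2
    have hdz : (d : ℝ) ≤ z := by exact_mod_cast hd.2
    have h1 : ((⌊x⌋₊ / (m * d) : ℕ) : ℝ) ≤ x / (m * d) := by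
      refine Nat.cast_div_le.trans ?_
      push_cast
      gcongr
      exact Nat.floor_le hx
    have hinv : ∀ n : ℝ, 0 < n → n ^ (-(1 - δ)) = n ^ δ * (1 / n) := fun n hn => by
      rw [show -(1 - δ) = δ + -1 by ring, Real.rpow_add hn, Real.rpow_neg_one, one_div]
    calc _ ≤ ((⌊x⌋₊ / (m * d) : ℕ) : ℝ) ^ (1 - δ) * E := card_smooth_le_rankin hδ0 hδ _ hy
      _ ≤ (x / (m * d)) ^ (1 - δ) * E := by
          gcongr
          linarith
      _ = x ^ (1 - δ) * E * ((m : ℝ) ^ δ * (d : ℝ) ^ δ) * (1 / m * (1 / d)) := by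
          rw [div_eq_mul_inv, Real.mul_rpow hx (by positivity), Real.inv_rpow (by positivity),
            ← Real.rpow_neg (by positivity), Real.mul_rpow hm0.le hd0.le, hinv m hm0, hinv d hd0]
          ring
      _ ≤ x ^ (1 - δ) * E * ((z : ℝ) ^ δ * (z : ℝ) ^ δ) * (1 / m * (1 / d)) := by
          gcongr
      _ = _ := by ring
  refine (sum_le_sum fun m hm => sum_le_sum fun d hd => hterm m hm d hd).trans ?_
  simp only [← mul_sum]
  rw [← sum_mul]
  have hs := sum_inv_le z
  have h0 : 0 ≤ ∑ d ∈ Ioc 0 z, (1 : ℝ) / d := by positivity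
  have : (∑ d ∈ Ioc 0 z, (1 : ℝ) / d) * ∑ d ∈ Ioc 0 z, (1 : ℝ) / d ≤ (1 + Real.log z) ^ 2 := by
    rw [sq]; gcongr
  gcongr

/-- The constants are slack in exponents: with log R ≤ 0.41T, the 0.03 is what separates 2 · 0.41
from 0.85 in the bound for log y, and 0.06 = 0.47 - 0.41 is what remains of the Rankin saving once R
is paid for. -/
lemma exists_log_threshold : ∃ L₀ : ℝ, 10 ≤ L₀ ∧ ∀ L : ℝ, L₀ ≤ L →
    Real.log 2 + 12 * Real.log L ≤ 0.03 * √L ∧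
    4 * (L ^ (0.4 : ℝ) * (9 + 4 * Real.log L)) + 4 * Real.log L + Real.log 4 ≤ 0.06 * √L := by
  have hone : (fun _ : ℝ => (1 : ℝ)) =o[Filter.atTop] (fun L : ℝ => L ^ (0.1 : ℝ)) := by
    rw [Asymptotics.isLittleO_const_left]
    right
    have := tendsto_rpow_atTop (y := (0.1 : ℝ)) (by norm_num)
    exact tendsto_norm_atTop_atTop.comp this
  have hlog := isLittleO_log_rpow_atTop (r := (0.1 : ℝ)) (by norm_num)
  have h94 : (fun L : ℝ => 9 + 4 * Real.log L) =o[Filter.atTop] (fun L : ℝ => L ^ (0.1 : ℝ)) := by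
    have := (hone.const_mul_left 9).add (hlog.const_mul_left 4)
    simpa using this
  have hhalf := isLittleO_log_rpow_atTop (r := (0.5 : ℝ)) (by norm_num)
  have hone' : (fun _ : ℝ => (1 : ℝ)) =o[Filter.atTop] (fun L : ℝ => L ^ (0.5 : ℝ)) := by
    rw [Asymptotics.isLittleO_const_left]
    right
    have := tendsto_rpow_atTop (y := (0.5 : ℝ)) (by norm_num)
    exact tendsto_norm_atTop_atTop.comp this
  have hprod : (fun L : ℝ => L ^ (0.4 : ℝ) * (9 + 4 * Real.log L))
      =o[Filter.atTop] (fun L : ℝ => L ^ (0.5 : ℝ)) := by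
    have := (Asymptotics.isBigO_refl (fun L : ℝ => L ^ (0.4 : ℝ)) Filter.atTop).mul_isLittleO h94
    refine this.congr' Filter.EventuallyEq.rfl ?_
    filter_upwards [Filter.eventually_gt_atTop 0] with L hL
    rw [← Real.rpow_add hL]
    norm_num
  have hA := (hone'.const_mul_left (Real.log 2)).add (hhalf.const_mul_left 12)
  have hB := ((hprod.const_mul_left 4).add (hhalf.const_mul_left 4)).add
    (hone'.const_mul_left (Real.log 4))
  have hA' := hA.bound (show (0 : ℝ) < 0.03 by norm_num)
  have hB' := hB.bound (show (0 : ℝ) < 0.06 by norm_num)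
  obtain ⟨L₁, hL₁⟩ := Filter.eventually_atTop.mp (hA'.and hB')
  refine ⟨max 10 L₁, le_max_left _ _, fun L hL => ?_⟩
  have hL0 : 0 ≤ L := by linarith [le_max_left 10 L₁]
  obtain ⟨h1, h2⟩ := hL₁ L ((le_max_right _ _).trans hL)
  have hs : ‖L ^ (0.5 : ℝ)‖ = √L := by
    rw [Real.norm_of_nonneg (by positivity), Real.sqrt_eq_rpow]
    norm_num
  rw [hs] at h1 h2
  rw [mul_one] at h1 h2
  exact ⟨(le_abs_self _).trans h1, (le_abs_self _).trans h2⟩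

/-- Smooth numbers save a factor `R`. -/
lemma sum_card_smooth_le_div {L R x : ℝ} (hL : 10 ≤ L)
    (hA : Real.log 2 + 12 * Real.log L ≤ 0.03 * √L)
    (hB : 4 * (L ^ (0.4 : ℝ) * (9 + 4 * Real.log L)) + 4 * Real.log L + Real.log 4 ≤ 0.06 * √L)
    (hx : x = Real.exp L) (hR1 : 1 ≤ R) (hR : R ≤ Real.exp (0.41 * √(L * Real.log L))) {y z : ℕ}
    (hy0 : 2 ≤ y) (hy : (y : ℝ) ≤ 2 * (R ^ 2 * L ^ 12)) (hz0 : 0 < z)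
    (hz : (z : ℝ) ≤ 2 * (R ^ 3 * L ^ 12)) :
    ∑ m ∈ Ioc 0 z, ∑ d ∈ Ioc 0 z, (#(Nat.smoothNumbersUpTo (⌊x⌋₊ / (m * d)) (y + 1)) : ℝ)
      ≤ x / R := by
  have hL0 : 0 < L := by linarith
  have hR0 : 0 < R := by linarith
  have hx0 : 0 < x := by rw [hx]; positivity
  set ll := Real.log L with hll
  have hll1 : 1 ≤ ll := by
    rw [hll, Real.le_log_iff_exp_le hL0]
    linarith [Real.exp_one_lt_d9]
  have hllL : ll ≤ L := (Real.log_le_sub_one_of_pos hL0).trans (by linarith)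
  set T := √(L * ll) with hT
  have hTsq : T ^ 2 = L * ll := Real.sq_sqrt (by positivity)
  have hT0 : 0 ≤ T := Real.sqrt_nonneg _
  have hsT : √L ≤ T := Real.sqrt_le_sqrt (by nlinarith)
  have hTL : T ≤ L := by
    rw [hT, Real.sqrt_le_left hL0.le]; nlinarith
  have hlogR : Real.log R ≤ 0.41 * T := by
    rw [← Real.log_exp (0.41 * T)]
    exact Real.log_le_log hR0 hR
  have hy0' : (0 : ℝ) < y := by exact_mod_cast (by omega : 0 < y)
  have hz0' : (0 : ℝ) < z := by exact_mod_cast hz0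
  have hlogy : Real.log y ≤ 0.85 * T := by
    have h1 := Real.log_le_log hy0' hy
    rw [Real.log_mul (by norm_num) (by positivity), Real.log_mul (by positivity) (by positivity),
      Real.log_pow, Real.log_pow] at h1
    push_cast at h1
    linarith
  have hlogz : Real.log z ≤ 1.3 * T := by
    have h1 := Real.log_le_log hz0' hz
    rw [Real.log_mul (by norm_num) (by positivity), Real.log_mul (by positivity) (by positivity),
      Real.log_pow, Real.log_pow] at h1
    push_cast at h1
    linarith
  -- Then x^(-δ) = exp(-0.47T) saves more than R, while 0.85 · 0.47 < 0.4 keeps y^δ ≤ L^0.4, so that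
  -- the Euler product costs only exp(o(√L)).
  set δ := 0.47 * T / L with hδdef
  have hδ0 : 0 ≤ δ := by positivity
  have hδ : δ ≤ 1 / 2 := by
    rw [hδdef, div_le_iff₀ hL0]; linarith
  have hδT : δ * T = 0.47 * ll := by
    rw [hδdef, div_mul_eq_mul_div, mul_assoc, ← sq, hTsq]; field_simp
  have hyδ : (y : ℝ) ^ δ ≤ L ^ (0.4 : ℝ) := by
    rw [Real.rpow_def_of_pos hy0', Real.rpow_def_of_pos hL0]
    apply Real.exp_le_exp.mpr
    nlinarith
  have hzδ : ((z : ℝ) ^ δ) ^ 2 ≤ Real.exp (2 * ll) := by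
    rw [Real.rpow_def_of_pos hz0', ← Real.exp_nat_mul]
    apply Real.exp_le_exp.mpr
    push_cast
    nlinarith
  have hzlog0 : 0 ≤ Real.log z := Real.log_natCast_nonneg z
  have hlog4 : Real.log 4 = 2 * Real.log 2 := by
    rw [show (4 : ℝ) = 2 ^ 2 by norm_num, Real.log_pow]; norm_num
  have hzlog : (1 + Real.log z) ^ 2 ≤ Real.exp (Real.log 4 + 2 * ll) := by
    have h1 : 1 + Real.log z ≤ 2 * L := by linarith
    have h2 : Real.exp (Real.log 4 + 2 * ll) = (2 * L) ^ 2 := by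
      rw [Real.exp_add, Real.exp_log (by norm_num), hll, mul_comm 2, Real.exp_mul,
        Real.exp_log hL0]
      norm_num; ring
    rw [h2]
    gcongr
  set J := Nat.log 2 y with hJ
  have hyJ : y ≤ 2 ^ (J + 1) := (Nat.lt_pow_succ_log_self (by norm_num) y).le
  have hJ1 : 1 ≤ J := by
    exact Nat.log_pos (by norm_num) hy0
  have hlogJ : Real.log J ≤ 1 + ll := by
    have h1 : (J : ℝ) * Real.log 2 ≤ Real.log y := by
      rw [← Real.log_pow]
      apply Real.log_le_log (by positivity)
      exact_mod_cast Nat.pow_log_le_self 2 (by omega : y ≠ 0)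
    have hl2 : (0.5 : ℝ) < Real.log 2 := by linarith [Real.log_two_gt_d9]
    have hJ0 : (0 : ℝ) < J := by exact_mod_cast hJ1
    have h2 : (J : ℝ) ≤ Real.exp 1 * L := by
      have := Real.add_one_le_exp (1 : ℝ)
      nlinarith
    calc Real.log J ≤ Real.log (Real.exp 1 * L) := Real.log_le_log hJ0 h2
      _ = 1 + ll := by rw [Real.log_mul (by positivity) hL0.ne', Real.log_exp]
  have hE : Real.exp (4 * ((y : ℝ) ^ δ * (5 + 4 * Real.log J)))
      ≤ Real.exp (4 * (L ^ (0.4 : ℝ) * (9 + 4 * ll))) := by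
    have hJ0 := Real.log_natCast_nonneg J
    apply Real.exp_le_exp.mpr
    have h5 : 5 + 4 * Real.log J ≤ 9 + 4 * ll := by linarith
    gcongr
  have hxδ : x ^ (1 - δ) = x * Real.exp (-(0.47 * T)) := by
    rw [Real.rpow_sub hx0, Real.rpow_one, Real.exp_neg, div_eq_mul_inv]
    congr 2
    rw [hx, ← Real.exp_mul, hδdef]
    congr 1
    field_simp
  refine (sum_card_smooth_le hδ0 hδ hx0.le hyJ z).trans ?_
  calc _ ≤ x * Real.exp (-(0.47 * T)) * Real.exp (4 * (L ^ (0.4 : ℝ) * (9 + 4 * ll)))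
          * Real.exp (2 * ll) * Real.exp (Real.log 4 + 2 * ll) := by
        rw [hxδ]; gcongr
    _ = x * Real.exp (-(0.47 * T) + 4 * (L ^ (0.4 : ℝ) * (9 + 4 * ll)) + 2 * ll
          + (Real.log 4 + 2 * ll)) := by
        rw [Real.exp_add _ (Real.log 4 + 2 * ll), Real.exp_add (_ + _) (2 * ll),
          Real.exp_add (-(0.47 * T))]
        ring
    _ ≤ x * Real.exp (-(0.41 * T)) := by
        gcongr
        linarith
    _ ≤ x / R := by
        rw [Real.exp_neg, div_eq_mul_inv]
        gcongr

end Smooth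

/-! ### Choice of cutoffs and conclusion. -/

lemma ceil_le_two_mul {t : ℝ} (ht : 1 ≤ t) : ((⌈t⌉₊ : ℕ) : ℝ) ≤ 2 * t := by
  have := Nat.ceil_lt_add_one (by linarith : 0 ≤ t)
  linarith

/-- This is the term m = d = 1; it lets one smooth estimate serve for both occurrences. -/
lemma card_smooth_le_sum (X Y : ℕ) {z : ℕ} (hz : 0 < z) :
    (#(Nat.smoothNumbersUpTo X Y) : ℝ)
      ≤ ∑ m ∈ Ioc 0 z, ∑ d ∈ Ioc 0 z, (#(Nat.smoothNumbersUpTo (X / (m * d)) Y) : ℝ) := by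
  have hone : 1 ∈ Ioc 0 z := mem_Ioc.mpr ⟨Nat.one_pos, hz⟩
  have h1 := single_le_sum (f := fun m => ∑ d ∈ Ioc 0 z,
    (#(Nat.smoothNumbersUpTo (X / (m * d)) Y) : ℝ))
    (fun m _ => sum_nonneg fun d _ => Nat.cast_nonneg _) hone
  have h2 := single_le_sum (f := fun d =>
    (#(Nat.smoothNumbersUpTo (X / (1 * d)) Y) : ℝ)) (fun d _ => Nat.cast_nonneg _) hone
  refine le_trans (le_of_eq ?_) (h2.trans h1)
  rw [one_mul, Nat.div_one]

/-- The bilinear contribution for the cutoffs `R ^ 2 L ^ 12` and `R ^ 3 L ^ 12`. -/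
lemma sum_ternaryDivisor_mul_maxPrimeSum_le {L R x α : ℝ} {a q h y z : ℕ} (hL : 1 ≤ L)
    (hx : x = Real.exp L) (hR : 1 ≤ R) (hh : 0 < h) (hhR : (h : ℝ) ≤ R) (hq : 0 < q)
    (hq1 : R ^ 12 * L ^ 26 ≤ q) (hq2 : (q : ℝ) ≤ x / (R ^ 11 * L ^ 26)) (haq : Nat.Coprime a q)
    (hα : |α - (a : ℝ) / q| ≤ 1 / (q : ℝ) ^ 2) (hz0 : 0 < z)
    (hy : R ^ 2 * L ^ 12 ≤ y) (hz : R ^ 3 * L ^ 12 ≤ z) :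
    ∑ l ∈ Ioc z (⌊x⌋₊ / y), ternaryDivisor l * maxPrimeSum ⌊x⌋₊ (α * h) l ≤ 3000 * (x / R) := by
  have hL0 : 0 < L := by linarith
  have hR0 : 0 < R := by linarith
  have hx0 : 0 < x := by rw [hx]; positivity
  have hlogx : Real.log x = L := by rw [hx, Real.log_exp]
  have hq' : (0 : ℝ) < q := by exact_mod_cast hq
  have hx1 : 1 ≤ x := by rw [hx]; exact Real.one_le_exp hL0.le
  set X := ⌊x⌋₊ with hX
  have hX1 : 1 ≤ X := Nat.le_floor (by simpa using hx1)
  have hX0 : (0 : ℝ) < X := by exact_mod_cast hX1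
  have hXx : (X : ℝ) ≤ x := Nat.floor_le hx0.le
  have hlogX : Real.log X ≤ L := by rw [← hlogx]; exact Real.log_le_log hX0 hXx
  have hlogX0 : 0 ≤ Real.log X := Real.log_natCast_nonneg X
  have hqx : (q : ℝ) ≤ x := hq2.trans (div_le_self hx0.le
    (one_le_mul_of_one_le_of_one_le (one_le_pow₀ hR) (one_le_pow₀ hL)))
  have hlogq : 1 + Real.log q ≤ 2 * L := by
    have : Real.log q ≤ L := by rw [← hlogx]; exact Real.log_le_log hq' hqx
    linarith
  have hlogq0 : 0 ≤ Real.log q := Real.log_natCast_nonneg q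
  have hK : ((Nat.log 2 X + 1 : ℕ) : ℝ) ≤ 3 * L := by
    have h1 : (Nat.log 2 X : ℝ) * Real.log 2 ≤ Real.log X := by
      rw [← Real.log_pow]
      apply Real.log_le_log (by positivity)
      exact_mod_cast Nat.pow_log_le_self 2 (by omega : X ≠ 0)
    have hl2 : (0.5 : ℝ) < Real.log 2 := by linarith [Real.log_two_gt_d9]
    push_cast
    nlinarith [Nat.cast_nonneg (α := ℝ) (Nat.log 2 X)]
  have hy0 : (0 : ℝ) < y := lt_of_lt_of_le (by positivity) hy
  have hz0' : (0 : ℝ) < z := by exact_mod_cast hz0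
  set B := x / (R ^ 2 * L ^ 12) with hB
  have hB0 : 0 < B := by positivity
  have hQ : ((X / y : ℕ) : ℝ) ≤ B := by
    refine Nat.cast_div_le.trans ?_
    rw [hB]
    gcongr
  have t1 : 16 * h * (X : ℝ) / q ≤ 16 * B := by
    have h1 : R ^ 3 * L ^ 12 ≤ R ^ 12 * L ^ 26 :=
      mul_le_mul (pow_le_pow_right₀ hR (by norm_num)) (pow_le_pow_right₀ hL (by norm_num))
        (by positivity) (by positivity)
    calc 16 * h * (X : ℝ) / q ≤ 16 * R * x / (R ^ 3 * L ^ 12) := by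
          gcongr
          exact h1.trans hq1
      _ = 16 * B := by rw [hB]; field_simp
  have t2 : 2 * (q : ℝ) * (1 + Real.log q) ≤ 4 * B := by
    have h1 : R ^ 2 * L ^ 13 ≤ R ^ 11 * L ^ 26 :=
      mul_le_mul (pow_le_pow_right₀ hR (by norm_num)) (pow_le_pow_right₀ hL (by norm_num))
        (by positivity) (by positivity)
    calc 2 * (q : ℝ) * (1 + Real.log q) ≤ 2 * (x / (R ^ 2 * L ^ 13)) * (2 * L) := by
          gcongr
          exact hq2.trans (by gcongr)
      _ = 4 * B := by rw [hB]; field_simp; ring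
  have t3 : 8 * h * (X : ℝ) * (1 + Real.log q) / z ≤ 16 * B * L := by
    calc 8 * h * (X : ℝ) * (1 + Real.log q) / z ≤ 8 * R * x * (2 * L) / (R ^ 3 * L ^ 12) := by
          gcongr
      _ = 16 * B * L := by rw [hB]; field_simp; ring
  have hmain := sum_ternaryDivisor_mul_maxPrimeSum_sq_le hq haq hα hh hz0
    (Nat.div_le_self X y)
  have hbound : (∑ l ∈ Ioc z (X / y), ternaryDivisor l * maxPrimeSum X (α * h) l) ^ 2
      ≤ (3000 * (x / R)) ^ 2 := by
    refine hmain.trans ?_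
    -- The powers of L are 9 from τ₃², 2 from the maximal inequality and 1 from the dyadic blocks or
    -- from log q. The L¹² in `B` cancels them, and its R² gives (x/R)².
    calc _ ≤ (2 * L) ^ 9 * (16 * (3 * L) ^ 2 * x * (3 * L * (9 * B + 16 * B + 4 * B)
            + 16 * B * L)) := by
          gcongr
          linarith
      _ = 7593984 * (x / R) ^ 2 := by rw [hB]; field_simp; ring
      _ ≤ (3000 * (x / R)) ^ 2 := by
          have : 0 ≤ (x / R) ^ 2 := by positivity
          rw [mul_pow]
          linarith
  exact (pow_le_pow_iff_left₀ (sum_nonneg fun l _ => mul_nonneg (ternaryDivisor_nonneg l)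
    (maxPrimeSum_nonneg _ _ _)) (by positivity) two_ne_zero).mp hbound

/-- The cutoff y must be large enough for the bilinear sum and small enough for Rankin; z carries
one more factor R than y, to absorb h ≤ R. -/
lemma norm_expSum_le_of_large {k : ℕ} {I : ℕ → Set ℝ} (hI : ∀ n, IsUnionOfIntervals k (I n))
    {L R x α : ℝ} {a q h : ℕ} (hL : 10 ≤ L)
    (hA : Real.log 2 + 12 * Real.log L ≤ 0.03 * √L)
    (hB : 4 * (L ^ (0.4 : ℝ) * (9 + 4 * Real.log L)) + 4 * Real.log L + Real.log 4 ≤ 0.06 * √L)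
    (hx : x = Real.exp L) (hR : 1 ≤ R) (hR2 : R ≤ Real.exp (0.41 * √(L * Real.log L)))
    (hh : 0 < h) (hhR : (h : ℝ) ≤ R) (hq : 0 < q)
    (hq1 : R ^ 12 * L ^ 26 ≤ q) (hq2 : (q : ℝ) ≤ x / (R ^ 11 * L ^ 26)) (haq : Nat.Coprime a q)
    (hα : |α - (a : ℝ) / q| ≤ 1 / (q : ℝ) ^ 2) :
    ‖expSum I x (α * h)‖ ≤ 2 ^ k * 7000 * (x / R) := by
  have hL1 : 1 ≤ L := by linarith
  have hR0 : 0 < R := by linarith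
  have hx0 : 0 < x := by rw [hx]; positivity
  set y := ⌈R ^ 2 * L ^ 12⌉₊ with hydef
  set z := ⌈R ^ 3 * L ^ 12⌉₊ with hzdef
  have hL12 : (10 : ℝ) ^ 12 ≤ L ^ 12 := by gcongr
  have h2 : (10 : ℝ) ^ 12 ≤ R ^ 2 * L ^ 12 :=
    hL12.trans (le_mul_of_one_le_left (by positivity) (one_le_pow₀ hR))
  have h3 : (10 : ℝ) ^ 12 ≤ R ^ 3 * L ^ 12 :=
    hL12.trans (le_mul_of_one_le_left (by positivity) (one_le_pow₀ hR))
  have hy : R ^ 2 * L ^ 12 ≤ y := Nat.le_ceil _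
  have hz : R ^ 3 * L ^ 12 ≤ z := Nat.le_ceil _
  have hy' : (y : ℝ) ≤ 2 * (R ^ 2 * L ^ 12) := ceil_le_two_mul (by linarith)
  have hz' : (z : ℝ) ≤ 2 * (R ^ 3 * L ^ 12) := ceil_le_two_mul (by linarith)
  have hy2 : 2 ≤ y := by
    have : (2 : ℝ) ≤ y := by linarith
    exact_mod_cast this
  have hz0 : 0 < z := by
    have : (0 : ℝ) < z := by linarith
    exact_mod_cast this
  have hz1 : (1 : ℝ) ≤ z := by exact_mod_cast hz0
  have hG : ∀ j ∈ Ioc 0 (z * z), ∀ s t : ℕ, ‖∑ n ∈ Ioc s t, e (α * h * j * n)‖ ≤ q := by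
    intro j hj s t
    rw [mem_Ioc] at hj
    refine norm_linear_sum_le hq haq hα hh hj.1 ?_ s t
    have hjz : (j : ℝ) ≤ z * z := by exact_mod_cast hj.2
    -- The lower bound on q has a surplus R⁵L², which exceeds 8 because L ≥ 10; this keeps hj ≤ q/2
    -- for every j ≤ z².
    have hLR : 8 * (R ^ 7 * L ^ 24) ≤ R ^ 12 * L ^ 26 := by
      have e1 : R ^ 12 * L ^ 26 = R ^ 5 * L ^ 2 * (R ^ 7 * L ^ 24) := by ring
      rw [e1]
      gcongr
      have : 1 ≤ R ^ 5 := one_le_pow₀ hR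
      nlinarith
    have : (2 : ℝ) * (h * j) ≤ q := by
      calc (2 : ℝ) * (h * j) ≤ 2 * (R * ((2 * (R ^ 3 * L ^ 12)) * (2 * (R ^ 3 * L ^ 12)))) := by
            gcongr
            exact hjz.trans (by gcongr)
        _ = 8 * (R ^ 7 * L ^ 24) := by ring
        _ ≤ q := hLR.trans hq1
    exact_mod_cast this
  have hmain := norm_expSum_le hI x (α * h) (by omega : 0 < y) hz0
    (norm_primeSum_le_max ⌊x⌋₊ (α * h)) hG
  have hbil := sum_ternaryDivisor_mul_maxPrimeSum_le hL1 hx hR hh hhR hq hq1 hq2 haq hα hz0 hy hz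
  have hsm := sum_card_smooth_le_div hL hA hB hx hR hR2 hy2 hy' hz0 hz'
  have hsm1 : (#(Nat.smoothNumbersUpTo ⌊x⌋₊ (y + 1)) : ℝ) ≤ x / R :=
    (card_smooth_le_sum ⌊x⌋₊ (y + 1) hz0).trans hsm
  -- The two bounds on q are compatible only if x is this large; that absorbs z⁴, of order R¹²L⁴⁸.
  have hxR : R ^ 23 * L ^ 52 ≤ x := by
    have h1 := hq1.trans hq2
    rw [le_div_iff₀ (by positivity)] at h1
    calc _ = R ^ 12 * L ^ 26 * (R ^ 11 * L ^ 26) := by ring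
      _ ≤ x := h1
  have hz4 : (z : ℝ) ^ 4 ≤ 16 * (x / R) := by
    have h4 : R ^ 13 * L ^ 48 ≤ R ^ 23 * L ^ 52 :=
      mul_le_mul (pow_le_pow_right₀ hR (by norm_num)) (pow_le_pow_right₀ hL1 (by norm_num))
        (by positivity) (by positivity)
    calc (z : ℝ) ^ 4 ≤ (2 * (R ^ 3 * L ^ 12)) ^ 4 := by gcongr
      _ = 16 * (R ^ 13 * L ^ 48 / R) := by field_simp; ring
      _ ≤ 16 * (x / R) := by
          gcongr
          exact h4.trans hxR
  have hz2 : (z : ℝ) ^ 2 ≤ 16 * (x / R) :=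
    (pow_le_pow_right₀ hz1 (by norm_num)).trans hz4
  have hzq : (z : ℝ) ^ 2 * q ≤ 4 * (x / R) := by
    have h5 : R * (R ^ 6 * L ^ 24) ≤ R ^ 11 * L ^ 26 := by
      calc R * (R ^ 6 * L ^ 24) = R ^ 7 * L ^ 24 := by ring
        _ ≤ R ^ 11 * L ^ 26 :=
          mul_le_mul (pow_le_pow_right₀ hR (by norm_num)) (pow_le_pow_right₀ hL1 (by norm_num))
            (by positivity) (by positivity)
    calc (z : ℝ) ^ 2 * q ≤ (2 * (R ^ 3 * L ^ 12)) ^ 2 * (x / (R * (R ^ 6 * L ^ 24))) := by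
          gcongr
          exact hq2.trans (by gcongr)
      _ = 4 * (x / R) := by field_simp; ring
  have hk : (1 : ℝ) ≤ 2 ^ k := one_le_pow₀ (by norm_num)
  have hxR0 : 0 ≤ x / R := by positivity
  refine hmain.trans ?_
  calc _ ≤ x / R + 16 * (x / R) + 2 ^ k * (4 * (x / R) + x / R + 16 * (x / R)
          + 2 * (3000 * (x / R))) := by
        gcongr
    _ ≤ 2 ^ k * 7000 * (x / R) := by nlinarith

lemma norm_expSum_le_self (I : ℕ → Set ℝ) {x : ℝ} (hx : 0 ≤ x) (γ : ℝ) :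
    ‖expSum I x γ‖ ≤ x := by
  classical
  rw [expSum_eq]
  refine (norm_sum_le _ _).trans (le_trans (sum_le_sum (g := fun _ => (1 : ℝ)) fun n _ => ?_) ?_)
  · split_ifs <;> simp
  · simpa using Nat.floor_le hx

end PrimeIntervalSeq

theorem theorem3 (κ : ℝ) (hκ : κ < 1 / Real.sqrt 6) (k : ℕ) :
    ∃ C : ℝ, ∀ I : ℕ → Set ℝ, (∀ n, PrimeIntervalSeq.IsUnionOfIntervals k (I n)) →
      ∀ x : ℝ, Real.exp 1 ≤ x →
      ∀ R : ℝ, 1 ≤ R →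
        R ≤ Real.exp (κ * Real.sqrt (Real.log x * Real.log (Real.log x))) →
      ∀ h a q : ℕ, 0 < h → 0 < a → 0 < q → (h : ℝ) ≤ R →
        R ^ 12 * Real.log x ^ 26 < (q : ℝ) →
        (q : ℝ) ≤ x / (R ^ 11 * Real.log x ^ 26) →
        Nat.Coprime a q →
      ∀ α : ℝ, |α - (a : ℝ) / (q : ℝ)| ≤ 1 / (q : ℝ) ^ 2 →
        ‖PrimeIntervalSeq.expSum I x (α * (h : ℝ))‖ ≤ C * (x / R) := by
  obtain ⟨L₀, hL₀, hthr⟩ := PrimeIntervalSeq.exists_log_threshold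
  refine ⟨max (2 ^ k * 7000) (Real.exp L₀), ?_⟩
  intro I hI x hx R hR hRx h a q hh _ hq hhR hq1 hq2 haq α hα
  have hx0 : 0 < x := (Real.exp_pos 1).trans_le hx
  have hR0 : 0 < R := by linarith
  have hL1 : 1 ≤ Real.log x := (Real.le_log_iff_exp_le hx0).mpr hx
  have hxL : x = Real.exp (Real.log x) := (Real.exp_log hx0).symm
  -- 1/√6 = 0.408…, so 0.41 can serve as a fixed exponent, and the threshold `L₀` is absolute.
  have hκ' : κ ≤ 0.41 := by
    refine hκ.le.trans ?_
    rw [div_le_iff₀ (by positivity)]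
    have : (2.44 : ℝ) ≤ √6 := Real.le_sqrt_of_sq_le (by norm_num)
    linarith
  have hR2 : R ≤ Real.exp (0.41 * √(Real.log x * Real.log (Real.log x))) :=
    hRx.trans (Real.exp_le_exp.mpr (mul_le_mul_of_nonneg_right hκ' (Real.sqrt_nonneg _)))
  have hxR0 : 0 ≤ x / R := by positivity
  rcases le_or_gt L₀ (Real.log x) with hL | hL
  · obtain ⟨hA, hB⟩ := hthr _ hL
    refine (PrimeIntervalSeq.norm_expSum_le_of_large hI (hL₀.trans hL) hA hB hxL hR hR2 hh hhR hq
      hq1.le hq2 haq hα).trans ?_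
    exact mul_le_mul_of_nonneg_right (le_max_left _ _) hxR0
  -- For bounded log x, R is bounded too, and the trivial bound x is a constant times x/R.
  · refine (PrimeIntervalSeq.norm_expSum_le_self I hx0.le _).trans ?_
    have hRL : R ≤ Real.exp L₀ := by
      refine hR2.trans (Real.exp_le_exp.mpr ?_)
      have hll : Real.log (Real.log x) ≤ Real.log x :=
        (Real.log_le_sub_one_of_pos (by linarith)).trans (by linarith)
      have hT : √(Real.log x * Real.log (Real.log x)) ≤ Real.log x := by
        rw [Real.sqrt_le_left (by linarith)]; nlinarith
      linarith
    calc x = R * (x / R) := by field_simp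
      _ ≤ Real.exp L₀ * (x / R) := by gcongr
      _ ≤ _ := mul_le_mul_of_nonneg_right (le_max_right _ _) hxR0
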